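/- Let $l,m\ge 1$ be integers, $n=(l+1)+(m+1)$, let $H:\mathbb{R}\to\mathbb{R}$ be continuous, and fix $s_0\in\mathbb{R}$. Consider the system for the generating curve $(x(s),y(s))$ of a generalized rotational hypersurface $\{(x(s)S^l,y(s)S^m)\}\subset\mathbb{R}^n$ of $O(l+1)\times O(m+1)$-type with mean curvature $H(s)$, $$l\,\frac{y'}{x}-m\,\frac{x'}{y}-(x''y'-x'y'')+(n-1)H(s)=0,\qquad (x')^2+(y')^2=1 .$$ A global solution curve is a pair of $C^1$ functions $x,y:\mathbb{R}\to\mathbb{R}$ such that (i) $x'(s)^2+y'(s)^2=1$ for all $s\in\mathbb{R}$; (ii) $x$ and $y$ are $C^2$ near every $s$ with $(x(s),y(s))\ne(0,0)$, and the first equation holds at every $s$ with $x(s)\neq0$ and $y(s)\ne 0$; (iii) the parameters $b$ with $x(b)=0$ or $y(b)=0$ form a closed discrete subset of $\mathbb{R}$ (the curve continues across an axis or the origin, so $x$ and $y$ may change sign), and at such $b$: $x'(b)=0$ if $y(b)=0\ne x(b)$; $y'(b)=0$ if $x(b)=0\neq y(b)$; and $x'(b)^2=\frac{l}{l+m}$,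 $y'(b)^2=\frac{m}{l+m}$ if $x(b)=y(b)=0$. Theorem 4.1. For all $c>0$, $d>0$ and all real numbers $c',d'$ with $(c')^2+(d')^2=1$ there exists a global solution curve $(x(s),y(s))$, $s\in\mathbb{R}$, with $x(s_0)=c$, $y(s_0)=d$, $x'(s_0)=c'$, $y'(s_0)=d'$. -/

import Mathlib

/-- The left-hand side of the first equation of the generating-curve system for hypersurfaces
`{(x(s) S^l, y(s) S^m)}` of `ℝⁿ`, `n = (l+1) + (m+1)`, of mean curvature `H(s)`:
`l y'/x - m x'/y - (x'' y' - x' y'') + (n-1) H`. -/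
noncomputable def generatingEq (l m n : ℕ) (H x y : ℝ → ℝ) (s : ℝ) : ℝ :=
  (l : ℝ) * (deriv y s / x s) - (m : ℝ) * (deriv x s / y s)
    - (deriv (deriv x) s * deriv y s - deriv x s * deriv (deriv y) s)
    + ((n : ℝ) - 1) * H s

/-- A global solution curve `(x(s), y(s))`, `s ∈ ℝ`, of the generating-curve system.

The curve is a plane curve parametrized by arc length which, when it reaches a coordinate axis or
the origin, is continued to the other side (so `x` and `y` are signed; the profile of the
hypersurface is `(|x|, |y|)`). The parameters at which it meets an axis are isolated. Away from them
the differential equation holds classically; at them the equation is singular and is replaced by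
the initial condition of the corresponding singular initial value problem: the axis is crossed
orthogonally, and the origin is crossed in a direction with `x'² = l/(l+m)`, `y'² = m/(l+m)`. The
curve is `C¹` everywhere and `C²` except possibly at the origin. -/
structure IsGlobalGeneratingCurve (l m n : ℕ) (H x y : ℝ → ℝ) : Prop where
  contDiff_x : ContDiff ℝ 1 x
  contDiff_y : ContDiff ℝ 1 y
  contDiffAt_two : ∀ s, ¬ (x s = 0 ∧ y s = 0) → ContDiffAt ℝ 2 x s ∧ ContDiffAt ℝ 2 y s
  unit_speed : ∀ s, deriv x s ^ 2 + deriv y s ^ 2 = 1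
  equation : ∀ s, x s ≠ 0 → y s ≠ 0 → generatingEq l m n H x y s = 0
  isolated : ∀ b, ∀ᶠ s in nhdsWithin b {b}ᶜ, x s ≠ 0 ∧ y s ≠ 0
  cross_x_axis : ∀ b, y b = 0 → x b ≠ 0 → deriv x b = 0
  cross_y_axis : ∀ b, x b = 0 → y b ≠ 0 → deriv y b = 0
  cross_origin : ∀ b, x b = 0 → y b = 0 →
    deriv x b ^ 2 = (l : ℝ) / ((l : ℝ) + (m : ℝ)) ∧
    deriv y b ^ 2 = (m : ℝ) / ((l : ℝ) + (m : ℝ))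

open Set Filter Topology

/-! With unit tangent (p, q) = (cos θ, sin θ) and F = (n - 1) H the system reads θ' = m p/y - l q/x
- F, singular only on the axes. Global existence rests on two facts: a curve on a finite interval
ends with admissible limit data (`exists_arrival`), and from any admissible data a curve departs
(`exists_departure`). Such pieces join across their common limit (`exists_join`), so no finite
endpoint is final; Zorn's lemma (`exists_continuation_Ioi`) and reversal of the parameter give the
whole line. Uniqueness plays no role.

Arrival: unit speed makes the position converge, so only the tangent is at stake. Off the axes the
curvature is bounded. At the axis y = 0 the quantity y q increases strictly to 0, so no zero of y
occurs shortly before the end, and L'Hôpital's rule for |y|^m p / |y|^m gives p → 0. At the origin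
(`arrival_origin`) let (ξ, η) be the direction of the position, C and S the radial and angular
components of the tangent, and w = |ξ|^l |η|^m. Up to a bounded error in its derivative w C is
nondecreasing, hence converges. A Lyapunov function with derivative at least (S² + f² C²)/(2r) -
const, where f = m ξ² - l η², stays bounded although 1/r is not integrable; hence S and f C come
arbitrarily close to 0. This forces the limit of w C to be minus the maximum of w, and strictness of
that maximum makes C and (ξ², η²) converge.

Departure: with θ = θ₀ + s ζ(s) the singular terms have linear part -k ζ, where k is the sum of the
multiplicities of the axes through the starting point. The equation becomes (s ζ)' + k ζ = g[ζ],
solved by contraction (`exists_singular_fixedPoint`) because g has Lipschitz constant at most k +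
1/2 (`exists_lipschitz_singular_term`, `Admissible.lipschitz_const_le`). -/

/-- The curvature `θ'` that the generating-curve system prescribes for a curve with position
`(x, y)` and unit tangent `(p, q) = (cos θ, sin θ)`; here `F = (n - 1) H`. -/
noncomputable def prescribedCurvature (l m : ℕ) (F x y p q : ℝ → ℝ) (s : ℝ) : ℝ :=
  m * (p s / y s) - l * (q s / x s) - F s

/-- The conditions on position `(X, Y)` and tangent `(P, Q)` of a generating curve at one parameter:
unit speed, and the prescribed directions on the axes and at the origin. -/
structure Admissible (l m : ℕ) (X Y P Q : ℝ) : Prop where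
  unit : P ^ 2 + Q ^ 2 = 1
  cross_x : Y = 0 → X ≠ 0 → P = 0
  cross_y : X = 0 → Y ≠ 0 → Q = 0
  cross_origin : X = 0 → Y = 0 → P ^ 2 = (l : ℝ) / (l + m) ∧ Q ^ 2 = (m : ℝ) / (l + m)

/-- `(x, y)` with tangent `(p, q)` is a generating curve near the parameter `s`. -/
structure IsCurveAt (l m : ℕ) (F x y p q : ℝ → ℝ) (s : ℝ) : Prop where
  deriv_x : HasDerivAt x (p s) s
  deriv_y : HasDerivAt y (q s) s
  cont_p : ContinuousAt p s
  cont_q : ContinuousAt q s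
  deriv_p : x s ≠ 0 → y s ≠ 0 → HasDerivAt p (-q s * prescribedCurvature l m F x y p q s) s
  deriv_q : x s ≠ 0 → y s ≠ 0 → HasDerivAt q (p s * prescribedCurvature l m F x y p q s) s
  isolated : ∀ᶠ t in 𝓝[≠] s, x t ≠ 0 ∧ y t ≠ 0
  admissible : Admissible l m (x s) (y s) (p s) (q s)

/-! ### Locality, removable parameters and symmetries -/

theorem IsCurveAt.congr {l m : ℕ} {F x y p q x₁ y₁ p₁ q₁ : ℝ → ℝ} {s : ℝ}
    (h : IsCurveAt l m F x y p q s) (hx : x =ᶠ[𝓝 s] x₁) (hy : y =ᶠ[𝓝 s] y₁)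
    (hp : p =ᶠ[𝓝 s] p₁) (hq : q =ᶠ[𝓝 s] q₁) : IsCurveAt l m F x₁ y₁ p₁ q₁ s := by
  have ex := hx.eq_of_nhds
  have ey := hy.eq_of_nhds
  have ep := hp.eq_of_nhds
  have eq := hq.eq_of_nhds
  have ek : prescribedCurvature l m F x y p q s = prescribedCurvature l m F x₁ y₁ p₁ q₁ s := by
    simp only [prescribedCurvature, ex, ey, ep, eq]
  refine ⟨?_, ?_, h.cont_p.congr hp, h.cont_q.congr hq, ?_, ?_, ?_, ?_⟩
  · rw [← ep]; exact h.deriv_x.congr_of_eventuallyEq hx.symm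
  · rw [← eq]; exact h.deriv_y.congr_of_eventuallyEq hy.symm
  · rw [← ek, ← eq, ← ex, ← ey]
    exact fun a b => (h.deriv_p a b).congr_of_eventuallyEq hp.symm
  · rw [← ek, ← ep, ← ex, ← ey]
    exact fun a b => (h.deriv_q a b).congr_of_eventuallyEq hq.symm
  · filter_upwards [h.isolated, hx.filter_mono nhdsWithin_le_nhds,
      hy.filter_mono nhdsWithin_le_nhds] with t ht h1 h2
    rwa [← h1, ← h2]
  · rw [← ex, ← ey, ← ep, ← eq]; exact h.admissible

/-- A function continuous at `b` whose derivative tends to `d` at `b` has derivative `d` at `b`. -/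
theorem hasDerivAt_of_tendsto_punctured {f f' : ℝ → ℝ} {b d : ℝ}
    (hf : ∀ᶠ s in 𝓝[≠] b, HasDerivAt f (f' s) s) (hc : ContinuousAt f b)
    (hd : Tendsto f' (𝓝[≠] b) (𝓝 d)) : HasDerivAt f d b := by
  rw [hasDerivAt_iff_tendsto_slope]
  have key := HasDerivAt.lhopital_zero_nhdsNE (a := b) (l := 𝓝 d) (f := fun s => f s - f b)
    (f' := f') (g := fun s => s - b) (g' := fun _ => 1)
    (hf.mono fun s hs => hs.sub_const _)
    (Eventually.of_forall fun s => (hasDerivAt_id s).sub_const _)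
    (Eventually.of_forall fun s => one_ne_zero)
    (by
      have : Tendsto (fun s => f s - f b) (𝓝 b) (𝓝 (f b - f b)) := hc.sub tendsto_const_nhds
      rw [sub_self] at this
      exact this.mono_left nhdsWithin_le_nhds)
    (by
      have : Tendsto (fun s : ℝ => s - b) (𝓝 b) (𝓝 (b - b)) := tendsto_id.sub tendsto_const_nhds
      rw [sub_self] at this
      exact this.mono_left nhdsWithin_le_nhds)
    (by simpa using hd)
  refine key.congr fun s => ?_
  rw [slope_def_field]

theorem continuousAt_prescribedCurvature {l m : ℕ} {F x y p q : ℝ → ℝ} {b : ℝ}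
    (hF : Continuous F) (hx : ContinuousAt x b) (hy : ContinuousAt y b) (hp : ContinuousAt p b)
    (hq : ContinuousAt q b) (h1 : x b ≠ 0) (h2 : y b ≠ 0) :
    ContinuousAt (prescribedCurvature l m F x y p q) b :=
  (((hp.div hy h2).const_mul _).sub ((hq.div hx h1).const_mul _)).sub hF.continuousAt

/-- A curve continuous at `b` with admissible data there that is a generating curve on a punctured
neighbourhood of `b` is a generating curve at `b`. -/
theorem isCurveAt_of_punctured {l m : ℕ} {F x y p q : ℝ → ℝ} {b : ℝ} (hF : Continuous F)
    (h : ∀ᶠ s in 𝓝[≠] b, IsCurveAt l m F x y p q s)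
    (hx : ContinuousAt x b) (hy : ContinuousAt y b) (hp : ContinuousAt p b)
    (hq : ContinuousAt q b) (hi : ∀ᶠ t in 𝓝[≠] b, x t ≠ 0 ∧ y t ≠ 0)
    (ha : Admissible l m (x b) (y b) (p b) (q b)) : IsCurveAt l m F x y p q b := by
  refine ⟨?_, ?_, hp, hq, fun h1 h2 => ?_, fun h1 h2 => ?_, hi, ha⟩
  · exact hasDerivAt_of_tendsto_punctured (h.mono fun s hs => hs.deriv_x) hx
      (hp.mono_left nhdsWithin_le_nhds)
  · exact hasDerivAt_of_tendsto_punctured (h.mono fun s hs => hs.deriv_y) hy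
      (hq.mono_left nhdsWithin_le_nhds)
  · refine hasDerivAt_of_tendsto_punctured
      ((h.and hi).mono fun s hs => hs.1.deriv_p hs.2.1 hs.2.2) hp ?_
    exact (hq.neg.mul (continuousAt_prescribedCurvature hF hx hy hp hq h1 h2)).mono_left
      nhdsWithin_le_nhds
  · refine hasDerivAt_of_tendsto_punctured
      ((h.and hi).mono fun s hs => hs.1.deriv_q hs.2.1 hs.2.2) hq ?_
    exact (hp.mul (continuousAt_prescribedCurvature hF hx hy hp hq h1 h2)).mono_left
      nhdsWithin_le_nhds

theorem Admissible.neg {l m : ℕ} {X Y P Q : ℝ} (h : Admissible l m X Y P Q) :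
    Admissible l m X Y (-P) (-Q) := by
  refine ⟨by simpa using h.unit, fun a b => by simpa using h.cross_x a b,
    fun a b => by simpa using h.cross_y a b, fun a b => by simpa using h.cross_origin a b⟩

theorem Admissible.swap {l m : ℕ} {X Y P Q : ℝ} (h : Admissible l m X Y P Q) :
    Admissible m l Y X Q P := by
  refine ⟨by rw [add_comm]; exact h.unit, h.cross_y, h.cross_x, fun a b => ?_⟩
  rw [add_comm (m : ℝ) l]
  exact (h.cross_origin b a).symm

/-- Reversal of the parameter. -/
theorem IsCurveAt.reverse {l m : ℕ} {F x y p q : ℝ → ℝ} {s : ℝ}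
    (h : IsCurveAt l m F x y p q (-s)) :
    IsCurveAt l m (fun t => -F (-t)) (fun t => x (-t)) (fun t => y (-t)) (fun t => -p (-t))
      (fun t => -q (-t)) s := by
  have hn : HasDerivAt (fun t : ℝ => -t) (-1) s := hasDerivAt_neg s
  have ht : Tendsto (fun t : ℝ => -t) (𝓝[≠] s) (𝓝[≠] (-s)) :=
    tendsto_nhdsWithin_of_tendsto_nhds_of_eventually_within _
      (hn.continuousAt.tendsto.mono_left nhdsWithin_le_nhds)
      (eventually_mem_nhdsWithin.mono fun t ht => by simpa [neg_eq_iff_eq_neg] using ht)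
  have hk : prescribedCurvature l m (fun t => -F (-t)) (fun t => x (-t)) (fun t => y (-t))
      (fun t => -p (-t)) (fun t => -q (-t)) s = - prescribedCurvature l m F x y p q (-s) := by
    simp only [prescribedCurvature]; ring
  refine ⟨?_, ?_, ?_, ?_, fun h1 h2 => ?_, fun h1 h2 => ?_, ht.eventually h.isolated,
    h.admissible.neg⟩
  · simpa [Function.comp_def] using h.deriv_x.comp s hn
  · simpa [Function.comp_def] using h.deriv_y.comp s hn
  · exact (ContinuousAt.comp (f := fun t : ℝ => -t) h.cont_p hn.continuousAt).neg
  · exact (ContinuousAt.comp (f := fun t : ℝ => -t) h.cont_q hn.continuousAt).neg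
  · rw [hk]
    refine ((h.deriv_p h1 h2).comp s hn).neg.congr_deriv ?_
    ring
  · rw [hk]
    refine ((h.deriv_q h1 h2).comp s hn).neg.congr_deriv ?_
    ring

/-- Interchange of the two coordinates. -/
theorem IsCurveAt.swap {l m : ℕ} {F x y p q : ℝ → ℝ} {s : ℝ}
    (h : IsCurveAt l m F x y p q s) : IsCurveAt m l (fun t => -F t) y x q p s := by
  have hk : prescribedCurvature m l (fun t => -F t) y x q p s
      = - prescribedCurvature l m F x y p q s := by
    simp only [prescribedCurvature]; ring
  refine ⟨h.deriv_y, h.deriv_x, h.cont_q, h.cont_p, fun h1 h2 => ?_, fun h1 h2 => ?_,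
    h.isolated.mono fun t ht => ht.symm, h.admissible.swap⟩
  · rw [hk]; exact (h.deriv_q h2 h1).congr_deriv (by ring)
  · rw [hk]; exact (h.deriv_p h2 h1).congr_deriv (by ring)

/-! ### Continuation to a half-line -/

/-- If a local property of functions on the line can always be continued past the right end of an
interval, it can be continued to a half-line. -/
theorem exists_continuation_Ioi {E : Type*} (Good : (ℝ → E) → ℝ → Prop)
    (hloc : ∀ f g s, f =ᶠ[𝓝 s] g → Good f s → Good g s) {a : ℝ}
    (hext : ∀ f b, a < b → (∀ s ∈ Ioo a b, Good f s) →
      ∃ b' > b, ∃ g, (∀ s ∈ Ioo a b', Good g s) ∧ EqOn f g (Ioo a b))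
    {f : ℝ → E} {b : ℝ} (hab : a < b) (hf : ∀ s ∈ Ioo a b, Good f s) :
    ∃ g, (∀ s ∈ Ioi a, Good g s) ∧ EqOn f g (Ioo a b) := by
  by_contra hcon
  let r : {u : ℝ × (ℝ → E) // b ≤ u.1 ∧ (∀ s ∈ Ioo a u.1, Good u.2 s) ∧ EqOn f u.2 (Ioo a b)} →
      {u : ℝ × (ℝ → E) // b ≤ u.1 ∧ (∀ s ∈ Ioo a u.1, Good u.2 s) ∧ EqOn f u.2 (Ioo a b)} → Prop :=
    fun u v => u.1.1 ≤ v.1.1 ∧ EqOn u.1.2 v.1.2 (Ioo a u.1.1)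
  have htrans : ∀ {u v w}, r u v → r v w → r u w := fun {u v w} h1 h2 =>
    ⟨h1.1.trans h2.1, fun s hs => (h1.2 hs).trans (h2.2 ⟨hs.1, hs.2.trans_le h1.1⟩)⟩
  -- Zorn's lemma for continuations ordered by prolongation. Different continuations need not agree;
  -- only agreement within a chain is used.
  obtain ⟨u, hu⟩ := exists_maximal_of_chains_bounded (r := r) (by
    intro c hc
    rcases c.eq_empty_or_nonempty with rfl | ⟨u₀, hu₀⟩
    · exact ⟨⟨(b, f), le_rfl, hf, fun s _ => rfl⟩, by simp⟩
    have hagree : ∀ u ∈ c, ∀ v ∈ c, ∀ s, a < s → s < u.1.1 → s < v.1.1 →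
        u.1.2 s = v.1.2 s := by
      intro u hu v hv s h0 h1 h2
      rcases eq_or_ne u v with rfl | hne
      · rfl
      rcases hc hu hv hne with h | h
      · exact h.2 ⟨h0, h1⟩
      · exact (h.2 ⟨h0, h2⟩).symm
    classical
    -- All members of the chain that reach beyond `s` agree there; where none does, the value is
    -- immaterial.
    let g : ℝ → E := fun s => if h : ∃ u ∈ c, s < u.1.1 then (Classical.choose h).1.2 s else f s
    have hg : ∀ u ∈ c, EqOn u.1.2 g (Ioo a u.1.1) := by
      intro u hu s hs
      have h : ∃ u ∈ c, s < u.1.1 := ⟨u, hu, hs.2⟩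
      simp only [g, dif_pos h]
      exact hagree u hu _ (Classical.choose_spec h).1 s hs.1 hs.2 (Classical.choose_spec h).2
    have hgood : ∀ u ∈ c, ∀ s ∈ Ioo a u.1.1, Good g s := fun u hu s hs =>
      hloc _ _ s ((hg u hu).eventuallyEq_of_mem (Ioo_mem_nhds hs.1 hs.2)) (u.2.2.1 s hs)
    have hgf : EqOn f g (Ioo a b) := fun s hs =>
      (u₀.2.2.2 hs).trans (hg u₀ hu₀ ⟨hs.1, hs.2.trans_le u₀.2.1⟩)
    by_cases hb : BddAbove ((fun u => u.1.1) '' c)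
    · refine ⟨⟨(sSup ((fun u => u.1.1) '' c), g), ?_, ?_, hgf⟩, fun u hu => ⟨?_, hg u hu⟩⟩
      · exact u₀.2.1.trans (le_csSup hb ⟨u₀, hu₀, rfl⟩)
      · intro s hs
        obtain ⟨_, ⟨u, hu, rfl⟩, h⟩ := exists_lt_of_lt_csSup (Set.Nonempty.image _ ⟨u₀, hu₀⟩) hs.2
        exact hgood u hu s ⟨hs.1, h⟩
      · exact le_csSup hb ⟨u, hu, rfl⟩
    -- If the right ends are unbounded, the glued function already solves the problem, against
    -- `hcon`.
    · refine absurd ⟨g, fun s hs => ?_, hgf⟩ hcon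
      obtain ⟨_, ⟨u, hu, rfl⟩, h⟩ := not_bddAbove_iff.1 hb s
      exact hgood u hu s ⟨hs, h⟩) htrans
  obtain ⟨b', hb', g, hg, hfg⟩ := hext u.1.2 u.1.1 (hab.trans_le u.2.1) u.2.2.1
  have := (hu ⟨(b', g), u.2.1.trans hb'.le, hg, fun s hs =>
    (u.2.2.2 hs).trans (hfg ⟨hs.1, hs.2.trans_le u.2.1⟩)⟩ ⟨hb'.le, hfg⟩).1
  exact absurd hb' (not_lt.2 this)

/-! ### Calculus at an endpoint and at a zero -/

/-- A function with bounded derivative on an interval has a limit at its right end. -/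
theorem exists_tendsto_left_of_deriv_bounded {f f' : ℝ → ℝ} {a b C : ℝ}
    (hf : ∀ s ∈ Ioo a b, HasDerivAt f (f' s) s) (hC : ∀ s ∈ Ioo a b, |f' s| ≤ C) (hab : a < b) :
    ∃ X, Tendsto f (𝓝[<] b) (𝓝 X) := by
  have hlip : LipschitzOnWith C.toNNReal f (Ioo a b) :=
    Convex.lipschitzOnWith_of_nnnorm_hasDerivWithin_le (convex_Ioo a b)
      (fun s hs => (hf s hs).hasDerivWithinAt) fun s hs => by
        rw [← NNReal.coe_le_coe, coe_nnnorm, Real.norm_eq_abs]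
        exact (hC s hs).trans (Real.le_coe_toNNReal C)
  obtain ⟨g, hg, hfg⟩ := hlip.extend_real
  refine ⟨g b, ((hg.continuous.tendsto b).mono_left nhdsWithin_le_nhds).congr' ?_⟩
  exact (hfg.eventuallyEq_of_mem (Ioo_mem_nhdsLT hab)).symm

/-- The factor |u|^k is kept in front of the logarithmic derivative so that these weights cancel in
quotients; both signs of `u` occur because curves cross the axes. -/
theorem HasDerivAt.abs_pow_of_ne {u : ℝ → ℝ} {u' s : ℝ} (k : ℕ) (hu : HasDerivAt u u' s)
    (h0 : u s ≠ 0) : HasDerivAt (fun t => |u t| ^ k) (|u s| ^ k * (k * (u' / u s))) s := by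
  have h1 : HasDerivAt (fun t => |u t|) (|u s| * (u' / u s)) s := by
    rcases lt_or_gt_of_ne h0 with h | h
    · have : (fun t => |u t|) =ᶠ[𝓝 s] fun t => -u t := by
        filter_upwards [hu.continuousAt.eventually_lt_const h] with t ht using abs_of_neg ht
      refine (hu.neg.congr_of_eventuallyEq this).congr_deriv ?_
      rw [abs_of_neg h]; field_simp
    · have : (fun t => |u t|) =ᶠ[𝓝 s] fun t => u t := by
        filter_upwards [hu.continuousAt.eventually_const_lt h] with t ht using abs_of_pos ht
      refine (hu.congr_of_eventuallyEq this).congr_deriv ?_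
      rw [abs_of_pos h]; field_simp
  refine (h1.fun_pow k).congr_deriv ?_
  rcases k with _ | k
  · simp
  · simp only [Nat.add_sub_cancel]; push_cast; ring

/-- A product of a factor vanishing to first order and a factor tending to zero has zero
derivative. -/
theorem hasDerivAt_mul_zero {A B : ℝ → ℝ} {b : ℝ} (hA : A =O[𝓝 b] fun t => t - b)
    (hA0 : A b = 0) (hB : ContinuousAt B b) (hB0 : B b = 0) :
    HasDerivAt (fun t => A t * B t) 0 b := by
  rw [hasDerivAt_iff_isLittleO]
  have : B =o[𝓝 b] fun _ => (1 : ℝ) := by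
    rw [Asymptotics.isLittleO_one_iff]
    have := hB.tendsto
    rwa [hB0] at this
  simpa [hA0] using hA.mul_isLittleO this

/-- A nonvanishing continuous function whose square has a limit has a limit. -/
theorem exists_tendsto_of_sq {f : ℝ → ℝ} {a b c : ℝ} (hab : a < b) (hf : ContinuousOn f (Ioo a b))
    (h0 : ∀ s ∈ Ioo a b, f s ≠ 0) (hc : Tendsto (fun s => f s ^ 2) (𝓝[<] b) (𝓝 c)) :
    ∃ d, d ^ 2 = c ∧ Tendsto f (𝓝[<] b) (𝓝 d) := by
  have hc0 : 0 ≤ c := ge_of_tendsto' hc fun s => sq_nonneg _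
  have habs : Tendsto (fun s => |f s|) (𝓝[<] b) (𝓝 (√c)) := by
    refine (hc.sqrt).congr fun s => Real.sqrt_sq_eq_abs _
  have hmem := Ioo_mem_nhdsLT hab
  have hsign : (∀ s ∈ Ioo a b, 0 < f s) ∨ (∀ s ∈ Ioo a b, f s < 0) := by
    by_contra! hcon
    obtain ⟨⟨s, hs, hs'⟩, ⟨t, ht, ht'⟩⟩ := hcon
    obtain ⟨u, hu, hu'⟩ := isPreconnected_Ioo.intermediate_value hs ht hf ⟨hs', ht'⟩
    exact h0 u hu hu'
  rcases hsign with h | h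
  · refine ⟨√c, Real.sq_sqrt hc0, habs.congr' ?_⟩
    filter_upwards [hmem] with s hs using abs_of_pos (h s hs)
  · refine ⟨-√c, by rw [neg_sq, Real.sq_sqrt hc0], habs.neg.congr' ?_⟩
    filter_upwards [hmem] with s hs
    rw [abs_of_neg (h s hs), neg_neg]

/-! ### Arrival at an axis -/

theorem Admissible.abs_le {l m : ℕ} {X Y P Q : ℝ} (h : Admissible l m X Y P Q) :
    |P| ≤ 1 ∧ |Q| ≤ 1 := by
  have := h.unit
  constructor <;> rw [← sq_le_one_iff_abs_le_one] <;> nlinarith [sq_nonneg P, sq_nonneg Q]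

theorem IsCurveAt.isBigO_abs_y {l m : ℕ} {F x y p q : ℝ → ℝ} {s : ℝ}
    (h : IsCurveAt l m F x y p q s) (hy : y s = 0) : (fun t => |y t|) =O[𝓝 s] fun t => t - s := by
  simpa [hy] using h.deriv_y.isBigO_sub.abs_left

theorem IsCurveAt.isBigO_abs_x {l m : ℕ} {F x y p q : ℝ → ℝ} {s : ℝ}
    (h : IsCurveAt l m F x y p q s) (hx : x s = 0) : (fun t => |x t|) =O[𝓝 s] fun t => t - s := by
  simpa [hx] using h.deriv_x.isBigO_sub.abs_left

/-- The derivative of `|y|ᵐ p` along a generating curve, including on the axis `y = 0`. -/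
theorem IsCurveAt.hasDerivAt_abs_y_pow_mul {l m : ℕ} (hm : 1 ≤ m) {F x y p q : ℝ → ℝ} {s : ℝ}
    (h : IsCurveAt l m F x y p q s) (hx : x s ≠ 0) :
    HasDerivAt (fun t => |y t| ^ m * p t) (|y s| ^ m * (q s * (l * (q s / x s) + F s))) s := by
  by_cases hy : y s = 0
  · obtain ⟨k, rfl⟩ : ∃ k, m = k + 1 := ⟨m - 1, by omega⟩
    -- One factor |y| is O(t - s); the rest vanishes at `s` even for k = 0, since the axis is
    -- crossed orthogonally.
    have h2 : HasDerivAt (fun t => |y t| * (|y t| ^ k * p t)) 0 s := by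
      refine hasDerivAt_mul_zero (h.isBigO_abs_y hy) (by simp [hy]) ?_ ?_
      · exact (h.deriv_y.continuousAt.abs.pow k).mul h.cont_p
      · rw [h.admissible.cross_x hy hx, mul_zero]
    refine (h2.congr_of_eventuallyEq (Eventually.of_forall fun t => ?_)).congr_deriv ?_
    · simp only; ring
    · simp [hy]
  -- The singular terms m p q/y coming from the weight and from p' cancel.
  · refine ((h.deriv_y.abs_pow_of_ne m hy).mul (h.deriv_p hx hy)).congr_deriv ?_
    simp only [prescribedCurvature]; field_simp; ring

/-- Arrival at a point of the axis `y = 0` off the origin. -/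
theorem arrival_x_axis {l m : ℕ} (hm : 1 ≤ m) {F x y p q : ℝ → ℝ} {a b X : ℝ}
    (hF : Continuous F) (hab : a < b) (h : ∀ s ∈ Ioo a b, IsCurveAt l m F x y p q s)
    (hx : Tendsto x (𝓝[<] b) (𝓝 X)) (hX : X ≠ 0) (hy : Tendsto y (𝓝[<] b) (𝓝 0)) :
    (∀ᶠ s in 𝓝[<] b, x s ≠ 0 ∧ y s ≠ 0) ∧ Tendsto p (𝓝[<] b) (𝓝 0) ∧
      ∃ Q, Q ^ 2 = 1 ∧ Tendsto q (𝓝[<] b) (𝓝 Q) := by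
  have hmR : (1 : ℝ) ≤ m := by exact_mod_cast hm
  -- `M` bounds the part l q/x + F of the curvature that stays regular near this axis.
  set M : ℝ := l * (2 / |X|) + (|F b| + 1) with hM
  have hXpos : 0 < |X| := abs_pos.2 hX
  have hMpos : 0 < M := by positivity
  have ev : ∀ᶠ s in 𝓝[<] b, s ∈ Ioo a b ∧ |X| / 2 < |x s| ∧ |F s| < |F b| + 1 ∧
      |y s| < 1 / (2 * M) := by
    have e1 : ∀ᶠ s in 𝓝[<] b, s ∈ Ioo a b := Ioo_mem_nhdsLT hab
    refine e1.and
      (((hx.abs).eventually_const_lt (half_lt_self hXpos)).and (Eventually.and ?_ ?_))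
    · exact (hF.abs.continuousAt.eventually_lt_const (lt_add_one |F b|)).filter_mono
        nhdsWithin_le_nhds
    · exact (hy.abs).eventually_lt_const (by rw [abs_zero]; positivity)
  obtain ⟨a', ha', hsub⟩ := (mem_nhdsLT_iff_exists_Ioo_subset).1 ev
  have hxne : ∀ s ∈ Ioo a' b, x s ≠ 0 := fun s hs =>
    abs_pos.1 ((half_pos hXpos).trans (hsub hs).2.1)
  have hcv : ∀ s ∈ Ioo a' b, IsCurveAt l m F x y p q s := fun s hs => h s (hsub hs).1
  have hg : ∀ s ∈ Ioo a' b, |l * (q s / x s) + F s| ≤ M := by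
    intro s hs
    refine (abs_add_le _ _).trans (add_le_add ?_ (hsub hs).2.2.1.le)
    rw [abs_mul, Nat.abs_cast, abs_div]
    refine mul_le_mul_of_nonneg_left ?_ (Nat.cast_nonneg l)
    rw [div_le_div_iff₀ (abs_pos.2 (hxne s hs)) hXpos]
    nlinarith [(hsub hs).2.1, (hcv s hs).admissible.abs_le.2, abs_nonneg X, abs_nonneg (q s)]
  -- y q is half the derivative of y². Its own derivative is q² + m p² - y p (l q/x + F), at least 1
  -- - 1/2 by the choice |y| < 1/(2M).
  have hKd : ∀ s ∈ Ioo a' b, ∃ k', 0 < k' ∧ HasDerivAt (fun t => y t * q t) k' s := by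
    intro s hs
    have hc := hcv s hs
    have hu := hc.admissible.unit
    by_cases h0 : y s = 0
    · refine ⟨1, one_pos, ?_⟩
      have hp0 := hc.admissible.cross_x h0 (hxne s hs)
      rw [hp0] at hu
      -- On the axis `q` is only known to be continuous, so it is frozen at its value there.
      have e : (fun t => y t * q t) = fun t => y t * q s + y t * (q t - q s) := by
        funext t; ring
      rw [e]
      have h2 : HasDerivAt (fun t => y t * (q t - q s)) 0 s := by
        refine hasDerivAt_mul_zero ?_ h0 (hc.cont_q.sub continuousAt_const) (by simp)
        simpa [h0] using hc.deriv_y.isBigO_sub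
      refine ((hc.deriv_y.mul_const (q s)).add h2).congr_deriv ?_
      nlinarith
    · refine ⟨_, ?_, hc.deriv_y.mul (hc.deriv_q (hxne s hs) h0)⟩
      have e : q s * q s + y s * (p s * prescribedCurvature l m F x y p q s)
          = q s ^ 2 + m * p s ^ 2 - y s * p s * (l * (q s / x s) + F s) := by
        simp only [prescribedCurvature]; field_simp; ring
      rw [e]
      have h3 : |y s * p s * (l * (q s / x s) + F s)| ≤ 1 / 2 := by
        rw [abs_mul, abs_mul]
        calc |y s| * |p s| * |l * (q s / x s) + F s| ≤ 1 / (2 * M) * 1 * M := by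
              gcongr
              · exact (hsub hs).2.2.2.le
              · exact hc.admissible.abs_le.1
              · exact hg s hs
          _ = 1 / 2 := by field_simp
      nlinarith [abs_le.1 h3, sq_nonneg (p s)]
  have hmono : StrictMonoOn (fun t => y t * q t) (Ioo a' b) := by
    refine strictMonoOn_of_deriv_pos (convex_Ioo _ _) (fun s hs => ?_) (fun s hs => ?_)
    · obtain ⟨k', -, hk⟩ := hKd s hs
      exact hk.continuousAt.continuousWithinAt
    · rw [interior_Ioo] at hs
      obtain ⟨k', hk0, hk⟩ := hKd s hs
      rwa [hk.deriv]
  have hysq : ∀ s ∈ Ioo a' b, HasDerivAt (fun t => y t ^ 2) (2 * (y s * q s)) s := fun s hs =>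
    ((hcv s hs).deriv_y.fun_pow 2).congr_deriv (by ring)
  -- After a zero of y the product y q is positive, so y² is nondecreasing; its limit 0 makes y
  -- vanish on an interval, against isolation.
  have hyne : ∀ s ∈ Ioo a' b, y s ≠ 0 := by
    intro s₁ hs₁ h0
    have hm2 : MonotoneOn (fun t => y t ^ 2) (Ico s₁ b) := by
      have hin : ∀ t ∈ Ico s₁ b, t ∈ Ioo a' b := fun t ht => ⟨hs₁.1.trans_le ht.1, ht.2⟩
      refine monotoneOn_of_deriv_nonneg (convex_Ico _ _) (fun s hs =>
        (hysq s (hin s hs)).continuousAt.continuousWithinAt) (fun s hs => ?_) (fun s hs => ?_)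
      · rw [interior_Ico] at hs
        exact (hysq s (hin s ⟨hs.1.le, hs.2⟩)).differentiableAt.differentiableWithinAt
      · rw [interior_Ico] at hs
        rw [(hysq s (hin s ⟨hs.1.le, hs.2⟩)).deriv]
        have := hmono hs₁ (hin s ⟨hs.1.le, hs.2⟩) hs.1
        simp only [h0, zero_mul] at this
        linarith
    have hz : ∀ t ∈ Ioo s₁ b, y t = 0 := by
      intro t ht
      have : y t ^ 2 ≤ 0 := by
        have hlim : Tendsto (fun t => y t ^ 2) (𝓝[<] b) (𝓝 0) := by simpa using hy.pow 2
        refine ge_of_tendsto hlim ?_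
        filter_upwards [Ioo_mem_nhdsLT ht.2] with u hu
        exact hm2 ⟨ht.1.le, ht.2⟩ ⟨(ht.1.trans hu.1).le, hu.2⟩ hu.1.le
      exact pow_eq_zero_iff two_ne_zero |>.1 (le_antisymm this (sq_nonneg _))
    have h1 := ((hcv s₁ hs₁).isolated.filter_mono (nhdsWithin_mono s₁ (fun t ht => ne_of_gt ht) :
      𝓝[>] s₁ ≤ 𝓝[≠] s₁))
    obtain ⟨t, ht1, ht2⟩ := (h1.and (Ioo_mem_nhdsGT hs₁.2)).exists
    exact ht1.2 (hz t ht2)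
  have hK0 : ∀ s ∈ Ioo a' b, y s * q s < 0 := by
    intro s hs
    obtain ⟨t, ht⟩ := exists_between hs.2
    have hlim : Tendsto (fun t => y t * q t) (𝓝[<] b) (𝓝 0) := by
      refine squeeze_zero_norm' ?_ (by simpa using hy.abs)
      filter_upwards [Ioo_mem_nhdsLT ha'] with u hu
      rw [Real.norm_eq_abs, abs_mul]
      exact mul_le_of_le_one_right (abs_nonneg _) (hcv u hu).admissible.abs_le.2
    have h1 : y t * q t ≤ 0 := by
      refine ge_of_tendsto hlim ?_
      filter_upwards [Ioo_mem_nhdsLT ht.2] with u hu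
      exact (hmono ⟨hs.1.trans ht.1, ht.2⟩ ⟨hs.1.trans (ht.1.trans hu.1), hu.2⟩ hu.1).le
    exact (hmono hs ⟨hs.1.trans ht.1, ht.2⟩ ht.1).trans_le h1
  have hmem : Ioo a' b ∈ 𝓝[<] b := Ioo_mem_nhdsLT ha'
  have hm0 : m ≠ 0 := by omega
  -- L'Hôpital for |y|^m p over |y|^m: the quotient of derivatives is y (l q/x + F)/m, which tends
  -- to 0.
  have hp : Tendsto p (𝓝[<] b) (𝓝 0) := by
    have hpow : Tendsto (fun s => |y s| ^ m) (𝓝[<] b) (𝓝 0) := by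
      simpa [hm0] using (hy.abs).pow m
    have key := HasDerivAt.lhopital_zero_nhdsLT (a := b) (l := 𝓝 (0 : ℝ))
      (f := fun t => |y t| ^ m * p t) (f' := fun s => |y s| ^ m * (q s * (l * (q s / x s) + F s)))
      (g := fun t => |y t| ^ m) (g' := fun s => |y s| ^ m * (m * (q s / y s)))
      (by filter_upwards [hmem] with s hs using
            (hcv s hs).hasDerivAt_abs_y_pow_mul hm (hxne s hs))
      (by filter_upwards [hmem] with s hs using
            (hcv s hs).deriv_y.abs_pow_of_ne m (hyne s hs))
      (by
        filter_upwards [hmem] with s hs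
        have := right_ne_zero_of_mul (hK0 s hs).ne
        have := hyne s hs
        have : (m : ℝ) ≠ 0 := by positivity
        positivity)
      (by
        refine squeeze_zero_norm' ?_ hpow
        filter_upwards [hmem] with s hs
        rw [Real.norm_eq_abs, abs_mul, abs_of_nonneg (by positivity : 0 ≤ |y s| ^ m)]
        exact mul_le_of_le_one_right (by positivity) (hcv s hs).admissible.abs_le.1)
      hpow
      (by
        have : Tendsto (fun s => |y s| * M) (𝓝[<] b) (𝓝 0) := by
          simpa using (hy.abs).mul_const M
        refine squeeze_zero_norm' ?_ this
        filter_upwards [hmem] with s hs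
        have h1 := right_ne_zero_of_mul (hK0 s hs).ne
        have h2 := hyne s hs
        have h3 : (m : ℝ) ≠ 0 := by positivity
        have e : |y s| ^ m * (q s * (l * (q s / x s) + F s)) / (|y s| ^ m * (m * (q s / y s)))
            = y s * (l * (q s / x s) + F s) / m := by
          have : |y s| ^ m ≠ 0 := by positivity
          generalize l * (q s / x s) + F s = g
          field_simp
        rw [e, Real.norm_eq_abs, abs_div, abs_mul, Nat.abs_cast]
        refine (div_le_self (by positivity) hmR).trans ?_
        exact mul_le_mul_of_nonneg_left (hg s hs) (abs_nonneg _))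
    refine key.congr' ?_
    filter_upwards [hmem] with s hs
    have h2 := hyne s hs
    have : |y s| ^ m ≠ 0 := by positivity
    field_simp
  refine ⟨?_, hp, ?_⟩
  · filter_upwards [hmem] with s hs using ⟨hxne s hs, hyne s hs⟩
  · refine exists_tendsto_of_sq ha' (fun s hs => (hcv s hs).cont_q.continuousWithinAt)
      (fun s hs => right_ne_zero_of_mul (hK0 s hs).ne) ?_
    have : Tendsto (fun s => 1 - p s ^ 2) (𝓝[<] b) (𝓝 1) := by
      simpa using (hp.pow 2).const_sub 1
    refine this.congr' ?_
    filter_upwards [hmem] with s hs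
    linarith [(hcv s hs).admissible.unit]

/-! ### Two inequalities for directions on the unit circle -/

/-- On `[0, 1]` the polynomial `aˡ (1 - a)ᵐ` has its strict maximum at `l / (l + m)`. -/
theorem pow_mul_pow_lt_max {l m : ℕ} (hl : 1 ≤ l) (hm : 1 ≤ m) {a : ℝ} (h0 : 0 ≤ a) (h1 : a ≤ 1)
    (hne : a ≠ (l : ℝ) / (l + m)) :
    a ^ l * (1 - a) ^ m < ((l : ℝ) / (l + m)) ^ l * (1 - (l : ℝ) / (l + m)) ^ m := by
  have hlR : (0 : ℝ) < l := by exact_mod_cast hl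
  have hmR : (0 : ℝ) < m := by exact_mod_cast hm
  have hc : 1 - (l : ℝ) / (l + m) = m / (l + m) := by field_simp; ring
  rw [hc]
  -- Weighted AM-GM: u and v are normalised so that l (u - 1) + m (v - 1) = 0, hence the exponential
  -- bounds multiply to 1.
  set u := a * (l + m) / l with hu
  set v := (1 - a) * (l + m) / m with hv
  have hau : a = l / (l + m) * u := by rw [hu]; field_simp
  have hav : 1 - a = m / (l + m) * v := by rw [hv]; field_simp
  have hu0 : 0 ≤ u := by positivity
  have hv0 : 0 ≤ v := div_nonneg (mul_nonneg (by linarith) (by positivity)) hmR.le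
  have hu1 : u ≠ 1 := by
    intro h; rw [h, mul_one] at hau; exact hne hau
  have e1 : u < Real.exp (u - 1) := by
    simpa using Real.add_one_lt_exp (sub_ne_zero.2 hu1)
  have e2 : v ≤ Real.exp (v - 1) := by simpa using Real.add_one_le_exp (v - 1)
  have key : u ^ l * v ^ m < 1 := by
    calc u ^ l * v ^ m ≤ u ^ l * Real.exp (v - 1) ^ m := by gcongr
      _ < Real.exp (u - 1) ^ l * Real.exp (v - 1) ^ m := by
        have : u ^ l < Real.exp (u - 1) ^ l := pow_lt_pow_left₀ e1 hu0 (by omega)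
        gcongr
      _ = 1 := by
        rw [← Real.exp_nat_mul, ← Real.exp_nat_mul, ← Real.exp_add, Real.exp_eq_one_iff, hu, hv]
        field_simp; ring
  rw [hav, mul_pow]
  nth_rewrite 1 [hau]
  rw [mul_pow]
  have hpos : 0 < ((l : ℝ) / (l + m)) ^ l * ((m : ℝ) / (l + m)) ^ m := by positivity
  nlinarith

theorem pow_mul_pow_le_max {l m : ℕ} (hl : 1 ≤ l) (hm : 1 ≤ m) {a : ℝ} (h0 : 0 ≤ a) (h1 : a ≤ 1) :
    a ^ l * (1 - a) ^ m ≤ ((l : ℝ) / (l + m)) ^ l * (1 - (l : ℝ) / (l + m)) ^ m := by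
  rcases eq_or_ne a ((l : ℝ) / (l + m)) with h | h
  · rw [← h]
  · exact (pow_mul_pow_lt_max hl hm h0 h1 h).le

/-- The coefficient estimate behind the Lyapunov function at the origin. -/
theorem exists_weight {l m : ℕ} (hl : 1 ≤ l) (hm : 1 ≤ m) :
    ∃ K : ℝ, 0 ≤ K ∧ ∀ ξ η : ℝ, ξ ^ 2 + η ^ 2 = 1 →
      1 / 2 + 1 / 2 * (l + m + 1) ^ 2 * (ξ ^ 2 * η ^ 2) ≤
        K * ((l + m + 1) * (|ξ| ^ l * |η| ^ m)) + ((ξ ^ 2 - η ^ 2) * (m * ξ ^ 2 - l * η ^ 2)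
          - 2 * (l + m) * (ξ ^ 2 * η ^ 2)) := by
  have hlR : (1 : ℝ) ≤ l := by exact_mod_cast hl
  have hmR : (1 : ℝ) ≤ m := by exact_mod_cast hm
  -- `M` collects the coefficients of ξ²η² from both sides. Where ξ²η² ≤ 1/(2M) the slack 1/2
  -- suffices; elsewhere |ξ| and |η| are at least 1/(2M), which bounds the weight |ξ|^l |η|^m from
  -- below and dictates `K`.
  set M : ℝ := 4 * (l + m) + 1 / 2 * (l + m + 1) ^ 2 with hM
  have hMpos : 0 < M := by positivity
  refine ⟨M * (2 * M) ^ (l + m), by positivity, fun ξ η h => ?_⟩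
  have e : (ξ ^ 2 - η ^ 2) * (m * ξ ^ 2 - l * η ^ 2)
      = m * ξ ^ 2 + l * η ^ 2 - 2 * (l + m) * (ξ ^ 2 * η ^ 2) := by
    have : η ^ 2 = 1 - ξ ^ 2 := by linarith
    rw [this]; ring
  have e1 : 1 ≤ m * ξ ^ 2 + l * η ^ 2 := by nlinarith [sq_nonneg ξ, sq_nonneg η]
  have hξ1 : ξ ^ 2 ≤ 1 := by nlinarith [sq_nonneg η]
  have hη1 : η ^ 2 ≤ 1 := by nlinarith [sq_nonneg ξ]
  have hw : 0 ≤ |ξ| ^ l * |η| ^ m := by positivity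
  suffices h2 : M * (ξ ^ 2 * η ^ 2) - 1 / 2
      ≤ M * (2 * M) ^ (l + m) * ((l + m + 1) * (|ξ| ^ l * |η| ^ m)) by
    rw [e]; rw [hM] at h2 ⊢; nlinarith
  rcases le_or_gt (M * (ξ ^ 2 * η ^ 2)) (1 / 2) with h3 | h3
  · have : 0 ≤ M * (2 * M) ^ (l + m) * ((l + m + 1) * (|ξ| ^ l * |η| ^ m)) := by positivity
    linarith
  have aux : ∀ u v : ℝ, u ^ 2 ≤ 1 → v ^ 2 ≤ 1 → 1 / 2 < M * (u ^ 2 * v ^ 2) → 1 ≤ 2 * M * |u| := by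
    intro u v hu hv huv
    have hu1 : |u| ≤ 1 := by rwa [← sq_le_one_iff_abs_le_one]
    have : u ^ 2 * v ^ 2 ≤ |u| := by
      calc u ^ 2 * v ^ 2 ≤ u ^ 2 * 1 := by gcongr
        _ = |u| * |u| := by rw [mul_one, ← sq_abs, sq]
        _ ≤ |u| * 1 := by gcongr
        _ = |u| := mul_one _
    nlinarith
  have h4 := aux ξ η hξ1 hη1 h3
  have h5 := aux η ξ hη1 hξ1 (by rwa [mul_comm (η ^ 2)])
  have h6 : 1 ≤ (2 * M) ^ (l + m) * (|ξ| ^ l * |η| ^ m) := by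
    have : (2 * M) ^ (l + m) * (|ξ| ^ l * |η| ^ m) = (2 * M * |ξ|) ^ l * (2 * M * |η|) ^ m := by
      rw [pow_add, mul_pow _ |ξ|, mul_pow _ |η|]; ring
    rw [this]
    exact one_le_mul_of_one_le_of_one_le (one_le_pow₀ h4) (one_le_pow₀ h5)
  have h7 : ξ ^ 2 * η ^ 2 ≤ 1 := mul_le_one₀ hξ1 (sq_nonneg _) hη1
  calc M * (ξ ^ 2 * η ^ 2) - 1 / 2 ≤ M * 1 := by nlinarith
    _ ≤ M * ((2 * M) ^ (l + m) * (|ξ| ^ l * |η| ^ m)) := by gcongr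
    _ ≤ M * ((2 * M) ^ (l + m) * (|ξ| ^ l * |η| ^ m)) * (l + m + 1) :=
        le_mul_of_one_le_right (by positivity) (by linarith)
    _ = _ := by ring

/-! ### Monotone approach to the origin -/

/-- The scaling momentum `|x|ˡ |y|ᵐ (x x' + y y')` is differentiable along a generating curve,
including on the axes and at the origin. -/
theorem IsCurveAt.hasDerivAt_momentum {l m : ℕ} (hl : 1 ≤ l) (hm : 1 ≤ m) {F x y p q : ℝ → ℝ}
    {s : ℝ} (h : IsCurveAt l m F x y p q s) :
    HasDerivAt (fun t => |x t| ^ l * |y t| ^ m * (x t * p t + y t * q t))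
      (|x s| ^ l * |y s| ^ m * (l + m + 1 - F s * (y s * p s - x s * q s))) s := by
  have hcx := h.deriv_x.continuousAt
  have hcy := h.deriv_y.continuousAt
  have hK : ContinuousAt (fun t => x t * p t + y t * q t) s :=
    (hcx.mul h.cont_p).add (hcy.mul h.cont_q)
  by_cases hy : y s = 0
  · obtain ⟨k, rfl⟩ : ∃ k, m = k + 1 := ⟨m - 1, by omega⟩
    have hK0 : x s * p s + y s * q s = 0 := by
      by_cases hx : x s = 0
      · simp [hx, hy]
      · simp [hy, h.admissible.cross_x hy hx]
    have h2 := hasDerivAt_mul_zero (h.isBigO_abs_y hy) (by simp [hy])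
      (((hcx.abs.pow l).mul (hcy.abs.pow k)).mul hK) (by simp only [Pi.mul_apply, hK0, mul_zero])
    refine (h2.congr_of_eventuallyEq (Eventually.of_forall fun t => ?_)).congr_deriv ?_
    · simp only [Pi.mul_apply, Pi.pow_apply]; ring
    · simp [hy]
  by_cases hx : x s = 0
  · obtain ⟨k, rfl⟩ : ∃ k, l = k + 1 := ⟨l - 1, by omega⟩
    have hK0 : x s * p s + y s * q s = 0 := by simp [hx, h.admissible.cross_y hx hy]
    have h2 := hasDerivAt_mul_zero (h.isBigO_abs_x hx) (by simp [hx])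
      (((hcx.abs.pow k).mul (hcy.abs.pow m)).mul hK) (by simp only [Pi.mul_apply, hK0, mul_zero])
    refine (h2.congr_of_eventuallyEq (Eventually.of_forall fun t => ?_)).congr_deriv ?_
    · simp only [Pi.mul_apply, Pi.pow_apply]; ring
    · simp [hx]
  · refine (((h.deriv_x.abs_pow_of_ne l hx).mul (h.deriv_y.abs_pow_of_ne m hy)).mul
      ((h.deriv_x.mul (h.deriv_p hx hy)).add (h.deriv_y.mul (h.deriv_q hx hy)))).congr_deriv ?_
    have hu : p s ^ 2 = 1 - q s ^ 2 := by linarith [h.admissible.unit]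
    simp only [prescribedCurvature, Pi.mul_apply, Pi.add_apply]
    field_simp
    ring_nf
    simp only [hu]
    ring

/-- A generating curve that tends to the origin meets no axis near it and approaches it
monotonically. -/
theorem approach_origin {l m : ℕ} (hl : 1 ≤ l) (hm : 1 ≤ m) {F x y p q : ℝ → ℝ} {a b : ℝ}
    (hF : Continuous F) (hab : a < b) (h : ∀ s ∈ Ioo a b, IsCurveAt l m F x y p q s)
    (hx : Tendsto x (𝓝[<] b) (𝓝 0)) (hy : Tendsto y (𝓝[<] b) (𝓝 0)) :
    ∃ a', a ≤ a' ∧ a' < b ∧ ∀ s ∈ Ioo a' b, x s ≠ 0 ∧ y s ≠ 0 ∧ x s * p s + y s * q s ≤ 0 ∧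
      |F s| ≤ |F b| + 1 := by
  have hMpos : 0 < |F b| + 1 := by positivity
  have e1 : ∀ᶠ s in 𝓝[<] b, s ∈ Ioo a b := Ioo_mem_nhdsLT hab
  -- These thresholds keep |F (y p - x q)| ≤ 2, below l + m + 1 ≥ 3, so the momentum is
  -- nondecreasing.
  have ev : ∀ᶠ s in 𝓝[<] b, s ∈ Ioo a b ∧ |x s| < 1 / (|F b| + 1) ∧ |y s| < 1 / (|F b| + 1) ∧
      |F s| < |F b| + 1 := by
    refine e1.and (((hx.abs).eventually_lt_const (by rw [abs_zero]; positivity)).and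
      (((hy.abs).eventually_lt_const (by rw [abs_zero]; positivity)).and ?_))
    exact (hF.abs.continuousAt.eventually_lt_const (lt_add_one |F b|)).filter_mono
        nhdsWithin_le_nhds
  obtain ⟨a', ha', hsub⟩ := (mem_nhdsLT_iff_exists_Ioo_subset).1 ev
  have hcv : ∀ s ∈ Ioo a' b, IsCurveAt l m F x y p q s := fun s hs => h s (hsub hs).1
  have hmono : MonotoneOn (fun t => |x t| ^ l * |y t| ^ m * (x t * p t + y t * q t))
      (Ioo a' b) := by
    have hd := fun s hs => (hcv s hs).hasDerivAt_momentum hl hm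
    refine monotoneOn_of_deriv_nonneg (convex_Ioo _ _) (fun s hs =>
      (hd s hs).continuousAt.continuousWithinAt) (fun s hs => ?_) (fun s hs => ?_)
    · rw [interior_Ioo] at hs
      exact (hd s hs).differentiableAt.differentiableWithinAt
    · rw [interior_Ioo] at hs
      rw [(hd s hs).deriv]
      have hA := (hcv s hs).admissible.abs_le
      obtain ⟨-, h1, h2, h3⟩ := hsub hs
      have hlR : (1 : ℝ) ≤ l := by exact_mod_cast hl
      have hmR : (1 : ℝ) ≤ m := by exact_mod_cast hm
      have h4 : |F s * (y s * p s - x s * q s)| ≤ 2 := by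
        rw [abs_mul]
        calc |F s| * |y s * p s - x s * q s|
            ≤ |F s| * (|y s * p s| + |x s * q s|) := by gcongr; exact abs_sub _ _
          _ = |F s| * (|y s| * |p s| + |x s| * |q s|) := by rw [abs_mul, abs_mul]
          _ ≤ (|F b| + 1) * (1 / (|F b| + 1) * 1 + 1 / (|F b| + 1) * 1) := by
            gcongr
            · exact hA.1
            · exact hA.2
          _ = 2 := by field_simp; norm_num
      refine mul_nonneg (by positivity) ?_
      linarith [(abs_le.1 h4).2]
  have hrd : ∀ s ∈ Ioo a' b, HasDerivAt (fun t => x t ^ 2 + y t ^ 2)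
      (2 * (x s * p s + y s * q s)) s := fun s hs =>
    (((hcv s hs).deriv_x.fun_pow 2).add ((hcv s hs).deriv_y.fun_pow 2)).congr_deriv
      (by ring)
  have hrlim : Tendsto (fun t => x t ^ 2 + y t ^ 2) (𝓝[<] b) (𝓝 0) := by
    simpa using (hx.pow 2).add (hy.pow 2)
  -- At an axis point the momentum is 0, so x p + y q ≥ 0 afterwards and r² = x² + y² is
  -- nondecreasing. Its limit 0 then keeps the curve at the origin, against isolation.
  have hne : ∀ s ∈ Ioo a' b, x s ≠ 0 ∧ y s ≠ 0 := by
    intro s₁ hs₁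
    by_contra hcon
    have hin : ∀ t ∈ Ico s₁ b, t ∈ Ioo a' b := fun t ht => ⟨hs₁.1.trans_le ht.1, ht.2⟩
    have hP1 : |x s₁| ^ l * |y s₁| ^ m * (x s₁ * p s₁ + y s₁ * q s₁) = 0 := by
      rcases not_and_or.1 hcon with h0 | h0
      · rw [not_not.1 h0, abs_zero, zero_pow (by omega)]; ring
      · rw [not_not.1 h0, abs_zero, zero_pow (by omega)]; ring
    have hpos : ∀ t ∈ Ioo s₁ b, x t ≠ 0 → y t ≠ 0 → 0 ≤ x t * p t + y t * q t := by
      intro t ht h1 h2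
      have := hmono hs₁ (hin t ⟨ht.1.le, ht.2⟩) ht.1.le
      simp only [hP1] at this
      exact nonneg_of_mul_nonneg_right this (by positivity)
    have hpos' : ∀ t ∈ Ioo s₁ b, 0 ≤ x t * p t + y t * q t := by
      intro t ht
      have hc := hcv t (hin t ⟨ht.1.le, ht.2⟩)
      have hcont : Tendsto (fun t => x t * p t + y t * q t) (𝓝[≠] t)
          (𝓝 (x t * p t + y t * q t)) :=
        ((hc.deriv_x.continuousAt.mul hc.cont_p).add
          (hc.deriv_y.continuousAt.mul hc.cont_q)).mono_left nhdsWithin_le_nhds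
      refine ge_of_tendsto hcont ?_
      filter_upwards [hc.isolated, mem_nhdsWithin_of_mem_nhds (Ioo_mem_nhds ht.1 ht.2)] with u h1 h2
      exact hpos u h2 h1.1 h1.2
    have hm2 : MonotoneOn (fun t => x t ^ 2 + y t ^ 2) (Ico s₁ b) := by
      refine monotoneOn_of_deriv_nonneg (convex_Ico _ _) (fun s hs =>
        (hrd s (hin s hs)).continuousAt.continuousWithinAt) (fun s hs => ?_) (fun s hs => ?_)
      · rw [interior_Ico] at hs
        exact (hrd s (hin s ⟨hs.1.le, hs.2⟩)).differentiableAt.differentiableWithinAt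
      · rw [interior_Ico] at hs
        rw [(hrd s (hin s ⟨hs.1.le, hs.2⟩)).deriv]
        have := hpos' s hs
        positivity
    have h1 := ((hcv s₁ hs₁).isolated.filter_mono (nhdsWithin_mono s₁ (fun t ht => ne_of_gt ht) :
      𝓝[>] s₁ ≤ 𝓝[≠] s₁))
    obtain ⟨t, ht1, ht⟩ := (h1.and (Ioo_mem_nhdsGT hs₁.2)).exists
    have h3 : x t ^ 2 + y t ^ 2 ≤ 0 := by
      refine ge_of_tendsto hrlim ?_
      filter_upwards [Ioo_mem_nhdsLT ht.2] with u hu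
      exact hm2 ⟨ht.1.le, ht.2⟩ ⟨(ht.1.trans hu.1).le, hu.2⟩ hu.1.le
    have := pow_pos (abs_pos.2 ht1.1) 2
    rw [sq_abs] at this
    nlinarith [sq_nonneg (y t)]
  have hPlim : Tendsto (fun t => |x t| ^ l * |y t| ^ m * (x t * p t + y t * q t)) (𝓝[<] b)
      (𝓝 0) := by
    have h1 : Tendsto (fun t => |x t| ^ l * |y t| ^ m * (|x t| + |y t|)) (𝓝[<] b) (𝓝 0) := by
      simpa using (((hx.abs).pow l).mul ((hy.abs).pow m)).mul (hx.abs.add hy.abs)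
    refine squeeze_zero_norm' ?_ h1
    filter_upwards [Ioo_mem_nhdsLT ha'] with t ht
    have hA := (hcv t ht).admissible.abs_le
    rw [Real.norm_eq_abs, abs_mul, abs_of_nonneg (by positivity : 0 ≤ |x t| ^ l * |y t| ^ m)]
    gcongr
    refine (abs_add_le _ _).trans (add_le_add ?_ ?_) <;> rw [abs_mul]
    · exact mul_le_of_le_one_right (abs_nonneg _) hA.1
    · exact mul_le_of_le_one_right (abs_nonneg _) hA.2
  have haa : a ≤ a' := by
    by_contra! hcon
    obtain ⟨t, ht⟩ := exists_between (lt_min hcon (show a' < b from ha'))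
    exact absurd (hsub ⟨ht.1, ht.2.trans_le (min_le_right _ _)⟩).1.1
      (not_lt.2 (ht.2.le.trans (min_le_left _ _)))
  refine ⟨a', haa, ha', fun s hs => ⟨(hne s hs).1, (hne s hs).2, ?_, (hsub hs).2.2.2.le⟩⟩
  -- A nondecreasing quantity with limit 0 is nonpositive.
  have h1 : |x s| ^ l * |y s| ^ m * (x s * p s + y s * q s) ≤ 0 := by
    refine ge_of_tendsto hPlim ?_
    filter_upwards [Ioo_mem_nhdsLT hs.2] with u hu
    exact hmono hs ⟨hs.1.trans hu.1, hu.2⟩ hu.1.le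
  have := (hne s hs).1
  have := (hne s hs).2
  exact nonpos_of_mul_nonpos_right h1 (by positivity)

/-! ### Convergence of the direction at the origin -/

/-- Polar data of a curve in the open quadrants: with `ξ = x / r`, `η = y / r` and the radial and
angular components `C`, `S` of the tangent, the generating-curve system reads as follows. -/
theorem polar_derivatives {l m : ℕ} {F x y p q : ℝ → ℝ} {s : ℝ} {r ξ η C S : ℝ → ℝ}
    (h : IsCurveAt l m F x y p q s) (hx : x s ≠ 0) (hy : y s ≠ 0)
    (hr : r = fun t => √(x t ^ 2 + y t ^ 2)) (hξ : ξ = fun t => x t / r t)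
    (hη : η = fun t => y t / r t) (hC : C = fun t => ξ t * p t + η t * q t)
    (hS : S = fun t => ξ t * q t - η t * p t) :
    0 < r s ∧ ξ s ≠ 0 ∧ η s ≠ 0 ∧ ξ s ^ 2 + η s ^ 2 = 1 ∧ C s ^ 2 + S s ^ 2 = 1 ∧
    HasDerivAt r (C s) s ∧
    HasDerivAt ξ (-(η s * S s) / r s) s ∧ HasDerivAt η (ξ s * S s / r s) s ∧
    HasDerivAt C (S s * ((l + m + 1) * S s - (m * (ξ s / η s) - l * (η s / ξ s)) * C s
      + r s * F s) / r s) s ∧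
    HasDerivAt S (C s * ((m * (ξ s / η s) - l * (η s / ξ s)) * C s - (l + m + 1) * S s
      - r s * F s) / r s) s := by
  have hpos : 0 < x s ^ 2 + y s ^ 2 := by positivity
  have hr0 : 0 < r s := by rw [hr]; exact Real.sqrt_pos.2 hpos
  have hrs : r s ^ 2 = x s ^ 2 + y s ^ 2 := by rw [hr]; exact Real.sq_sqrt hpos.le
  have hxs : x s = r s * ξ s := by rw [hξ]; field_simp
  have hys : y s = r s * η s := by rw [hη]; field_simp
  have hξ0 : ξ s ≠ 0 := by rw [hξ]; exact div_ne_zero hx hr0.ne'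
  have hη0 : η s ≠ 0 := by rw [hη]; exact div_ne_zero hy hr0.ne'
  have hu : ξ s ^ 2 + η s ^ 2 = 1 := by
    rw [hξ, hη]; field_simp; exact hrs.symm
  have hpq := h.admissible.unit
  have hCs : C s = ξ s * p s + η s * q s := by rw [hC]
  have hSs : S s = ξ s * q s - η s * p s := by rw [hS]
  have hp : p s = ξ s * C s - η s * S s := by
    rw [hCs, hSs]; linear_combination (-p s) * hu
  have hq : q s = η s * C s + ξ s * S s := by
    rw [hCs, hSs]; linear_combination (-q s) * hu
  have hCS : C s ^ 2 + S s ^ 2 = 1 := by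
    rw [hCs, hSs]; linear_combination (p s ^ 2 + q s ^ 2) * hu + hpq
  have dr : HasDerivAt r (C s) s := by
    have h1 := (((h.deriv_x.fun_pow 2).add (h.deriv_y.fun_pow 2)).sqrt (by simpa using hpos.ne'))
    rw [hr]
    refine h1.congr_deriv ?_
    have : √(((fun t => x t ^ 2) + fun t => y t ^ 2) s) = r s := by rw [hr]; rfl
    rw [this, hCs, hxs, hys]
    field_simp
    push_cast
    ring
  have dξ : HasDerivAt ξ (-(η s * S s) / r s) s := by
    rw [hξ]
    refine (h.deriv_x.div dr hr0.ne').congr_deriv ?_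
    rw [hxs, hp]
    field_simp
    ring
  have dη : HasDerivAt η (ξ s * S s / r s) s := by
    rw [hη]
    refine (h.deriv_y.div dr hr0.ne').congr_deriv ?_
    rw [hys, hq]
    field_simp
    ring
  have hk : prescribedCurvature l m F x y p q s
      = ((m * (ξ s / η s) - l * (η s / ξ s)) * C s - (l + m) * S s - r s * F s) / r s := by
    rw [prescribedCurvature, hxs, hys, hp, hq]
    field_simp
    ring
  refine ⟨hr0, hξ0, hη0, hu, hCS, dr, dξ, dη, ?_, ?_⟩
  · rw [hC]
    refine ((dξ.mul (h.deriv_p hx hy)).add (dη.mul (h.deriv_q hx hy))).congr_deriv ?_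
    have : -(η s * S s) / r s * p s + ξ s * (-q s * prescribedCurvature l m F x y p q s)
        + (ξ s * S s / r s * q s + η s * (p s * prescribedCurvature l m F x y p q s))
        = S s * (ξ s * q s - η s * p s) / r s
          - (ξ s * q s - η s * p s) * prescribedCurvature l m F x y p q s := by ring
    rw [this, ← hSs, hk]
    simp only [← hCs]
    field_simp
    ring
  · rw [hS]
    refine ((dξ.mul (h.deriv_q hx hy)).sub (dη.mul (h.deriv_p hx hy))).congr_deriv ?_
    have : -(η s * S s) / r s * q s + ξ s * (p s * prescribedCurvature l m F x y p q s)
        - (ξ s * S s / r s * p s + η s * (-q s * prescribedCurvature l m F x y p q s))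
        = -(S s * (ξ s * p s + η s * q s)) / r s
          + (ξ s * p s + η s * q s) * prescribedCurvature l m F x y p q s := by ring
    rw [this, ← hCs, hk]
    simp only [← hSs]
    field_simp
    ring

/-- A bounded function cannot have derivative at least `ε / (b - s) - M` up to `b`. -/
theorem not_deriv_ge_log {L L' : ℝ → ℝ} {a b ε M B : ℝ} (hab : a < b) (hε : 0 < ε)
    (hd : ∀ s ∈ Ioo a b, HasDerivAt L (L' s) s) (hL : ∀ s ∈ Ioo a b, |L s| ≤ B)
    (hge : ∀ s ∈ Ioo a b, ε / (b - s) - M ≤ L' s) : False := by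
  -- This sum is nondecreasing by hypothesis, yet the logarithm drives it to -∞.
  have hmono : MonotoneOn (fun s => L s + ε * Real.log (b - s) + M * s) (Ioo a b) := by
    have hd2 : ∀ s ∈ Ioo a b, HasDerivAt (fun s => L s + ε * Real.log (b - s) + M * s)
        (L' s - ε / (b - s) + M) s := by
      intro s hs
      have h1 : HasDerivAt (fun s : ℝ => b - s) (-1) s := (hasDerivAt_id s).const_sub b
      refine (((hd s hs).add ((h1.log (sub_pos.2 hs.2).ne').const_mul ε)).add
        ((hasDerivAt_id s).const_mul M)).congr_deriv ?_
      ring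
    refine monotoneOn_of_deriv_nonneg (convex_Ioo _ _) (fun s hs =>
      (hd2 s hs).continuousAt.continuousWithinAt) (fun s hs => ?_) (fun s hs => ?_)
    · rw [interior_Ioo] at hs
      exact (hd2 s hs).differentiableAt.differentiableWithinAt
    · rw [interior_Ioo] at hs
      rw [(hd2 s hs).deriv]
      linarith [hge s hs]
  obtain ⟨s₁, hs₁⟩ := exists_between hab
  have hlim : Tendsto (fun s => ε * Real.log (b - s)) (𝓝[<] b) atBot := by
    refine Tendsto.const_mul_atBot hε (Real.tendsto_log_nhdsGT_zero.comp ?_)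
    refine tendsto_nhdsWithin_of_tendsto_nhds_of_eventually_within _ ?_ ?_
    · have : Tendsto (fun s : ℝ => b - s) (𝓝 b) (𝓝 (b - b)) :=
        tendsto_const_nhds.sub tendsto_id
      rw [sub_self] at this
      exact this.mono_left nhdsWithin_le_nhds
    · filter_upwards [self_mem_nhdsWithin] with s hs using sub_pos.2 (mem_Iio.1 hs)
  obtain ⟨s, h1, h2⟩ := ((hlim.eventually_lt_atBot
    (L s₁ + ε * Real.log (b - s₁) + M * s₁ - B - |M| * (|a| + |b|))).and
      (Ioo_mem_nhdsLT hs₁.2)).exists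
  have h3 := hmono hs₁ ⟨hs₁.1.trans h2.1, h2.2⟩ h2.1.le
  have h4 := (abs_le.1 (hL s ⟨hs₁.1.trans h2.1, h2.2⟩)).2
  have h5 : M * s ≤ |M| * (|a| + |b|) := by
    refine (le_abs_self _).trans ?_
    rw [abs_mul]
    gcongr
    rw [abs_le]
    constructor
    · linarith [neg_abs_le a, abs_nonneg b, hs₁.1, h2.1]
    · linarith [le_abs_self b, abs_nonneg a, h2.2]
  simp only at h3
  linarith

/-- Arrival at the origin: the tangent has a limit, which is one of the prescribed directions. -/
theorem arrival_origin {l m : ℕ} (hl : 1 ≤ l) (hm : 1 ≤ m) {F x y p q : ℝ → ℝ} {a b : ℝ}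
    (hF : Continuous F) (hab : a < b) (h : ∀ s ∈ Ioo a b, IsCurveAt l m F x y p q s)
    (hx : Tendsto x (𝓝[<] b) (𝓝 0)) (hy : Tendsto y (𝓝[<] b) (𝓝 0)) :
    (∀ᶠ s in 𝓝[<] b, x s ≠ 0 ∧ y s ≠ 0) ∧
      ∃ P Q, P ^ 2 = (l : ℝ) / (l + m) ∧ Q ^ 2 = (m : ℝ) / (l + m) ∧
        Tendsto p (𝓝[<] b) (𝓝 P) ∧ Tendsto q (𝓝[<] b) (𝓝 Q) := by
  obtain ⟨a', haa, ha', hap⟩ := approach_origin hl hm hF hab h hx hy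
  have hlR : (1 : ℝ) ≤ l := by exact_mod_cast hl
  have hmR : (1 : ℝ) ≤ m := by exact_mod_cast hm
  set M := |F b| + 1 with hM
  have hcv : ∀ s ∈ Ioo a' b, IsCurveAt l m F x y p q s := fun s hs =>
    h s ⟨haa.trans_lt hs.1, hs.2⟩
  obtain ⟨r, hr⟩ : ∃ r : ℝ → ℝ, r = fun t => √(x t ^ 2 + y t ^ 2) := ⟨_, rfl⟩
  obtain ⟨ξ, hξ⟩ : ∃ ξ : ℝ → ℝ, ξ = fun t => x t / r t := ⟨_, rfl⟩
  obtain ⟨η, hη⟩ : ∃ η : ℝ → ℝ, η = fun t => y t / r t := ⟨_, rfl⟩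
  obtain ⟨C, hC⟩ : ∃ C : ℝ → ℝ, C = fun t => ξ t * p t + η t * q t := ⟨_, rfl⟩
  obtain ⟨S, hS⟩ : ∃ S : ℝ → ℝ, S = fun t => ξ t * q t - η t * p t := ⟨_, rfl⟩
  have hpol := fun s (hs : s ∈ Ioo a' b) =>
    polar_derivatives (hcv s hs) (hap s hs).1 (hap s hs).2.1 hr hξ hη hC hS
  have hmem : Ioo a' b ∈ 𝓝[<] b := Ioo_mem_nhdsLT ha'
  have hCS1 : ∀ s ∈ Ioo a' b, |C s| ≤ 1 ∧ |S s| ≤ 1 ∧ |ξ s| ≤ 1 ∧ |η s| ≤ 1 := by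
    intro s hs
    obtain ⟨-, -, -, h1, h2, -⟩ := hpol s hs
    refine ⟨?_, ?_, ?_, ?_⟩ <;> rw [← sq_le_one_iff_abs_le_one] <;>
      nlinarith [sq_nonneg (C s), sq_nonneg (S s), sq_nonneg (ξ s), sq_nonneg (η s)]
  have hC0 : ∀ s ∈ Ioo a' b, C s ≤ 0 := by
    intro s hs
    have : C s = (x s * p s + y s * q s) / r s := by rw [hC, hξ, hη]; ring
    rw [this]
    exact div_nonpos_of_nonpos_of_nonneg (hap s hs).2.2.1 (hpol s hs).1.le
  -- r' = C ≥ -1 and r → 0. Hence 1/r ≥ 1/(b - s), which is not integrable.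
  have hrb : ∀ s ∈ Ioo a' b, r s ≤ b - s := by
    have hanti : MonotoneOn (fun s => r s + s) (Ioo a' b) := by
      have hd : ∀ s ∈ Ioo a' b, HasDerivAt (fun s => r s + s) (C s + 1) s := fun s hs =>
        (hpol s hs).2.2.2.2.2.1.add (hasDerivAt_id s)
      refine monotoneOn_of_deriv_nonneg (convex_Ioo _ _) (fun s hs =>
        (hd s hs).continuousAt.continuousWithinAt) (fun s hs => ?_) (fun s hs => ?_)
      · rw [interior_Ioo] at hs
        exact (hd s hs).differentiableAt.differentiableWithinAt
      · rw [interior_Ioo] at hs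
        rw [(hd s hs).deriv]
        linarith [(abs_le.1 (hCS1 s hs).1).1]
    have hlim : Tendsto (fun s => r s + s) (𝓝[<] b) (𝓝 b) := by
      have h1 : Tendsto r (𝓝[<] b) (𝓝 0) := by
        rw [hr]; simpa using ((hx.pow 2).add (hy.pow 2)).sqrt
      simpa using h1.add (tendsto_id.mono_left nhdsWithin_le_nhds : Tendsto id (𝓝[<] b) (𝓝 b))
    intro s hs
    have : r s + s ≤ b := by
      refine ge_of_tendsto hlim ?_
      filter_upwards [Ioo_mem_nhdsLT hs.2] with u hu
      exact hanti hs ⟨hs.1.trans hu.1, hu.2⟩ hu.1.le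
    linarith
  -- w C is the scaling momentum divided by r^(l+m+1).
  obtain ⟨w, hw⟩ : ∃ w : ℝ → ℝ, w = fun t => |ξ t| ^ l * |η t| ^ m := ⟨_, rfl⟩
  have hw0 : ∀ s, 0 ≤ w s := fun s => by rw [hw]; positivity
  have hw1 : ∀ s ∈ Ioo a' b, w s ≤ 1 := fun s hs => by
    rw [hw]
    exact mul_le_one₀ (pow_le_one₀ (abs_nonneg _) (hCS1 s hs).2.2.1) (by positivity)
      (pow_le_one₀ (abs_nonneg _) (hCS1 s hs).2.2.2)
  have dG : ∀ s ∈ Ioo a' b, HasDerivAt (fun t => w t * C t)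
      (w s * ((l + m + 1) * S s ^ 2 + r s * F s * S s) / r s) s := by
    intro s hs
    obtain ⟨hr0, h1, h2, -, -, -, dξ, dη, dC, -⟩ := hpol s hs
    rw [hw]
    refine (((dξ.abs_pow_of_ne l h1).mul (dη.abs_pow_of_ne m h2)).mul dC).congr_deriv ?_
    simp only [Pi.mul_apply]
    field_simp
    ring
  -- As in a monotonicity formula, the derivative of w C is a nonnegative multiple of S²/r plus an
  -- error of size at most `M`; the upper bound comes from C ≤ 0.
  obtain ⟨g, hg⟩ : ∃ g, Tendsto (fun t => w t * C t) (𝓝[<] b) (𝓝 g) := by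
    have hmono : MonotoneOn (fun t => w t * C t + M * t) (Ioo a' b) := by
      have hd : ∀ s ∈ Ioo a' b, HasDerivAt (fun t => w t * C t + M * t)
          (w s * ((l + m + 1) * S s ^ 2 + r s * F s * S s) / r s + M * 1) s := fun s hs =>
        (dG s hs).add ((hasDerivAt_id s).const_mul M)
      refine monotoneOn_of_deriv_nonneg (convex_Ioo _ _) (fun s hs =>
        (hd s hs).continuousAt.continuousWithinAt) (fun s hs => ?_) (fun s hs => ?_)
      · rw [interior_Ioo] at hs
        exact (hd s hs).differentiableAt.differentiableWithinAt
      · rw [interior_Ioo] at hs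
        rw [(hd s hs).deriv]
        have hr0 := (hpol s hs).1
        have e : w s * ((l + m + 1) * S s ^ 2 + r s * F s * S s) / r s
            = w s * ((l + m + 1) * S s ^ 2) / r s + w s * (F s * S s) := by field_simp
        have h1 : |w s * (F s * S s)| ≤ 1 * (M * 1) := by
          rw [abs_mul, abs_mul, abs_of_nonneg (hw0 s)]
          gcongr
          · exact hw1 s hs
          · exact (hap s hs).2.2.2
          · exact (hCS1 s hs).2.1
        have h2 : 0 ≤ w s * ((l + m + 1) * S s ^ 2) / r s := by
          have := hw0 s
          positivity
        rw [e]
        linarith [(abs_le.1 h1).1]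
    have hbdd : BddAbove ((fun t => w t * C t + M * t) '' Ioo a' b) := by
      refine ⟨M * b, ?_⟩
      rintro _ ⟨s, hs, rfl⟩
      have h1 : w s * C s ≤ 0 := mul_nonpos_of_nonneg_of_nonpos (hw0 s) (hC0 s hs)
      have h2 : M * s ≤ M * b := by gcongr; exact hs.2.le
      simp only
      linarith
    have h1 := hmono.tendsto_nhdsWithin_Ioo_left (nonempty_Ioo.2 ha') hbdd
    have h2 : Tendsto (fun t : ℝ => M * t) (𝓝[<] b) (𝓝 (M * b)) :=
      (tendsto_id.const_mul M).mono_left nhdsWithin_le_nhds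
    exact ⟨_, (h1.sub h2).congr fun t => by ring⟩
  set f : ℝ → ℝ := fun t => m * ξ t ^ 2 - l * η t ^ 2 with hf
  obtain ⟨K, hK0, hK⟩ := exists_weight hl hm
  -- The Lyapunov function. The term w C controls S²/r only where w is not small; the correction ξ η
  -- f S adds f² C²/r, which detects directions other than the critical one f = 0, and through
  -- `exists_weight` it controls S²/r near the axes.
  have dL : ∀ s ∈ Ioo a' b, HasDerivAt (fun t => K * (w t * C t) + ξ t * η t * f t * S t)
      (((K * ((l + m + 1) * w s) + ((ξ s ^ 2 - η s ^ 2) * f s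
        - 2 * (l + m) * (ξ s ^ 2 * η s ^ 2))) * S s ^ 2 + f s ^ 2 * C s ^ 2
        - (l + m + 1) * (ξ s * η s) * f s * S s * C s) / r s
        + F s * (K * w s * S s - ξ s * η s * f s * C s)) s := by
    intro s hs
    obtain ⟨hr0, h1, h2, -, -, -, dξ, dη, -, dS⟩ := hpol s hs
    have df : HasDerivAt f (-2 * (l + m) * (ξ s * η s) * S s / r s) s := by
      refine (((dξ.fun_pow 2).const_mul (m : ℝ)).sub ((dη.fun_pow 2).const_mul (l : ℝ))).congr_deriv
        ?_
      field_simp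
      push_cast
      ring
    refine (((dG s hs).const_mul K).add (((dξ.mul dη).mul df).mul dS)).congr_deriv ?_
    simp only [Pi.mul_apply, hf]
    field_simp
    ring
  have hfreq : ∀ ε > 0, ∃ᶠ s in 𝓝[<] b, S s ^ 2 + f s ^ 2 * C s ^ 2 < ε := by
    intro ε hε hcon
    have hcon2 : ∀ᶠ s in 𝓝[<] b, s ∈ Ioo a' b ∧ ε ≤ S s ^ 2 + f s ^ 2 * C s ^ 2 :=
      (show ∀ᶠ s in 𝓝[<] b, s ∈ Ioo a' b from hmem).and (hcon.mono fun s hs => not_lt.1 hs)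
    obtain ⟨a₂, ha₂, hsub⟩ := (mem_nhdsLT_iff_exists_Ioo_subset).1 hcon2
    have hf1 : ∀ s ∈ Ioo a' b, |ξ s * η s * f s| ≤ l + m := by
      intro s hs
      obtain ⟨-, -, h1, h2⟩ := hCS1 s hs
      rw [abs_mul, abs_mul]
      have h3 : |f s| ≤ l + m := by
        have := (sq_le_one_iff_abs_le_one _).2 h1
        have := (sq_le_one_iff_abs_le_one _).2 h2
        rw [abs_le]
        constructor <;> simp only [hf] <;> nlinarith [sq_nonneg (ξ s), sq_nonneg (η s)]
      calc |ξ s| * |η s| * |f s| ≤ 1 * 1 * (l + m) := by gcongr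
        _ = l + m := by ring
    refine not_deriv_ge_log (L := fun t => K * (w t * C t) + ξ t * η t * f t * S t)
      (ε := ε / 2) (M := M * (K + (l + m))) (B := K + (l + m)) ha₂ (half_pos hε)
      (fun s hs => dL s (hsub hs).1) (fun s hs => ?_) (fun s hs => ?_)
    · have hs' := (hsub hs).1
      refine (abs_add_le _ _).trans (add_le_add ?_ ?_)
      · rw [abs_mul, abs_mul, abs_of_nonneg hK0, abs_of_nonneg (hw0 s)]
        calc K * (w s * |C s|) ≤ K * (1 * 1) := by
              gcongr
              · exact hw1 s hs'
              · exact (hCS1 s hs').1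
          _ = K := by ring
      · rw [abs_mul]
        calc |ξ s * η s * f s| * |S s| ≤ (l + m) * 1 := by
              gcongr
              · exact hf1 s hs'
              · exact (hCS1 s hs').2.1
          _ = l + m := by ring
    · have hs' := (hsub hs).1
      obtain ⟨hr0, -, -, hu, -, -⟩ := hpol s hs'
      have hKs := hK _ _ hu
      have hε2 := (hsub hs).2
      have hww : |ξ s| ^ l * |η s| ^ m = w s := by rw [hw]
      rw [hww] at hKs
      -- The cross term is absorbed by the square `h2`, at the cost of half of f² C² and of the S²
      -- term provided for in `exists_weight`.
      have hmain : ε / 2 ≤ (K * ((l + m + 1) * w s) + ((ξ s ^ 2 - η s ^ 2) * f s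
        - 2 * (l + m) * (ξ s ^ 2 * η s ^ 2))) * S s ^ 2 + f s ^ 2 * C s ^ 2
        - (l + m + 1) * (ξ s * η s) * f s * S s * C s := by
        have h1 := mul_le_mul_of_nonneg_right hKs (sq_nonneg (S s))
        have h2 := sq_nonneg (f s * C s - (l + m + 1) * (ξ s * η s) * S s)
        have h3 : f s = m * ξ s ^ 2 - l * η s ^ 2 := rfl
        rw [← h3] at h1
        nlinarith
      have herr : |F s * (K * w s * S s - ξ s * η s * f s * C s)| ≤ M * (K + (l + m)) := by
        rw [abs_mul]
        refine mul_le_mul (hap s hs').2.2.2 ?_ (abs_nonneg _) (by positivity)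
        refine (abs_sub _ _).trans (add_le_add ?_ ?_)
        · rw [abs_mul, abs_mul, abs_of_nonneg hK0, abs_of_nonneg (hw0 s)]
          calc K * w s * |S s| ≤ K * 1 * 1 := by
                gcongr
                · exact hw1 s hs'
                · exact (hCS1 s hs').2.1
            _ = K := by ring
        · rw [abs_mul]
          calc |ξ s * η s * f s| * |C s| ≤ (l + m) * 1 := by
                gcongr
                · exact hf1 s hs'
                · exact (hCS1 s hs').1
            _ = l + m := by ring
      have hdiv : ε / 2 / (b - s) ≤ ((K * ((l + m + 1) * w s) + ((ξ s ^ 2 - η s ^ 2) * f s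
        - 2 * (l + m) * (ξ s ^ 2 * η s ^ 2))) * S s ^ 2 + f s ^ 2 * C s ^ 2
        - (l + m + 1) * (ξ s * η s) * f s * S s * C s) / r s :=
        div_le_div₀ ((half_pos hε).le.trans hmain) hmain hr0 (hrb s hs')
      linarith [(abs_le.1 herr).1]
  set c : ℝ := (l : ℝ) / (l + m) with hc
  set φ : ℝ → ℝ := fun a => a ^ l * (1 - a) ^ m with hφ
  have hφc : Continuous φ := by fun_prop
  have hcpos : 0 < φ c := by
    have : 1 - c = m / (l + m) := by rw [hc]; field_simp; ring
    simp only [hφ, this]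
    positivity
  have hwφ : ∀ s ∈ Ioo a' b, w s ^ 2 = φ (ξ s ^ 2) := by
    intro s hs
    have : 1 - ξ s ^ 2 = η s ^ 2 := by linarith [(hpol s hs).2.2.2.1]
    simp only [hw, hφ, this]
    rw [mul_pow, ← pow_mul, ← pow_mul, mul_comm l, mul_comm m, pow_mul, pow_mul, sq_abs, sq_abs]
  have hξI : ∀ s ∈ Ioo a' b, ξ s ^ 2 ∈ Icc (0 : ℝ) 1 := fun s hs =>
    ⟨sq_nonneg _, (sq_le_one_iff_abs_le_one _).2 (hCS1 s hs).2.2.1⟩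
  have hwle : ∀ s ∈ Ioo a' b, w s ≤ √(φ c) := fun s hs => by
    rw [← Real.sqrt_sq (hw0 s), hwφ s hs]
    exact Real.sqrt_le_sqrt (pow_mul_pow_le_max hl hm (hξI s hs).1 (hξI s hs).2)
  -- Along an ultrafilter on which S² + f² C² → 0 one has S → 0, C → -1 (as C ≤ 0) and f → 0, so ξ²
  -- → c. This identifies the limit of w C, which exists along the full filter.
  have hgval : g = -√(φ c) := by
    have hcl : MapClusterPt 0 (𝓝[<] b) (fun s => S s ^ 2 + f s ^ 2 * C s ^ 2) := by
      rw [mapClusterPt_iff_frequently]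
      intro U hU
      obtain ⟨ε, hε, hball⟩ := Metric.mem_nhds_iff.1 hU
      refine (hfreq ε hε).mono fun s hs => hball ?_
      rw [Metric.mem_ball, Real.dist_eq, sub_zero, abs_of_nonneg (by positivity)]
      exact hs
    obtain ⟨U, hU, hU0⟩ := mapClusterPt_iff_ultrafilter.1 hcl
    have hmemU : Ioo a' b ∈ (U : Filter ℝ) := hU hmem
    have hS2 : Tendsto (fun s => S s ^ 2) U (𝓝 0) :=
      squeeze_zero (fun s => sq_nonneg _) (fun s => by nlinarith [sq_nonneg (f s * C s)]) hU0
    have hfC : Tendsto (fun s => f s ^ 2 * C s ^ 2) U (𝓝 0) :=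
      squeeze_zero (fun s => by positivity) (fun s => by nlinarith [sq_nonneg (S s)]) hU0
    have hC2 : Tendsto (fun s => C s ^ 2) U (𝓝 1) := by
      have : Tendsto (fun s => 1 - S s ^ 2) U (𝓝 1) := by simpa using hS2.const_sub 1
      refine this.congr' ?_
      filter_upwards [hmemU] with s hs
      linarith [(hpol s hs).2.2.2.2.1]
    have hCm : Tendsto C U (𝓝 (-1)) := by
      have : Tendsto (fun s => -√(C s ^ 2)) U (𝓝 (-1)) := by simpa using hC2.sqrt.neg
      refine this.congr' ?_
      filter_upwards [hmemU] with s hs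
      rw [Real.sqrt_sq_eq_abs, abs_of_nonpos (hC0 s hs), neg_neg]
    have hf2 : Tendsto (fun s => f s ^ 2) U (𝓝 0) := by
      have : Tendsto (fun s => f s ^ 2 * C s ^ 2 / C s ^ 2) U (𝓝 0) := by
        have h1 := hfC.div hC2 one_ne_zero
        rwa [zero_div] at h1
      refine this.congr' ?_
      filter_upwards [hC2.eventually_ne one_ne_zero] with s hs
      exact mul_div_cancel_right₀ _ hs
    have hf0 : Tendsto f U (𝓝 0) := by
      rw [tendsto_zero_iff_abs_tendsto_zero]
      have : Tendsto (fun s => √(f s ^ 2)) U (𝓝 0) := by simpa using hf2.sqrt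
      exact this.congr fun s => Real.sqrt_sq_eq_abs _
    have hξ2 : Tendsto (fun s => ξ s ^ 2) U (𝓝 c) := by
      have : Tendsto (fun s => (f s + l) / (l + m)) U (𝓝 c) := by
        simpa using (hf0.add_const (l : ℝ)).div_const ((l : ℝ) + m)
      refine this.congr' ?_
      filter_upwards [hmemU] with s hs
      have : η s ^ 2 = 1 - ξ s ^ 2 := by linarith [(hpol s hs).2.2.2.1]
      simp only [hf, this]
      field_simp
      ring
    have hwU : Tendsto w U (𝓝 (√(φ c))) := by
      refine ((hφc.continuousAt.tendsto.comp hξ2).sqrt).congr' ?_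
      filter_upwards [hmemU] with s hs
      simp only [Function.comp]
      rw [← hwφ s hs, Real.sqrt_sq (hw0 s)]
    have h1 := hwU.mul hCm
    rw [mul_neg_one] at h1
    exact tendsto_nhds_unique (hg.mono_left hU) h1
  rw [hgval] at hg
  have hsq : 0 < √(φ c) := Real.sqrt_pos.2 hcpos
  -- Squeeze: -w C ≤ w ≤ √(φ c), and the left side now tends to the right one.
  have hwlim : Tendsto w (𝓝[<] b) (𝓝 (√(φ c))) := by
    have hneg : Tendsto (fun t => -(w t * C t)) (𝓝[<] b) (𝓝 (√(φ c))) := by simpa using hg.neg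
    refine tendsto_of_tendsto_of_tendsto_of_le_of_le' hneg tendsto_const_nhds ?_ ?_
    · filter_upwards [hmem] with s hs
      have := (abs_le.1 (hCS1 s hs).1).1
      nlinarith [hw0 s]
    · filter_upwards [hmem] with s hs using hwle s hs
  have hClim : Tendsto C (𝓝[<] b) (𝓝 (-1)) := by
    have h1 := hg.div hwlim hsq.ne'
    rw [neg_div, div_self hsq.ne'] at h1
    refine h1.congr' ?_
    filter_upwards [hwlim.eventually_ne hsq.ne'] with s hs
    simp only [Pi.div_apply]
    field_simp
  have hSlim : Tendsto S (𝓝[<] b) (𝓝 0) := by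
    rw [tendsto_zero_iff_abs_tendsto_zero]
    have : Tendsto (fun s => √(1 - C s ^ 2)) (𝓝[<] b) (𝓝 0) := by
      simpa using ((hClim.pow 2).const_sub 1).sqrt
    refine this.congr' ?_
    filter_upwards [hmem] with s hs
    rw [show 1 - C s ^ 2 = S s ^ 2 by linarith [(hpol s hs).2.2.2.2.1], Real.sqrt_sq_eq_abs]
    rfl
  -- By compactness it suffices to test cluster values z: they satisfy φ z = φ c, and the maximum at
  -- c is strict.
  have hξ2 : Tendsto (fun s => ξ s ^ 2) (𝓝[<] b) (𝓝 c) := by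
    refine isCompact_Icc.tendsto_nhds_of_unique_mapClusterPt
      (show ∀ᶠ s in 𝓝[<] b, ξ s ^ 2 ∈ Icc (0 : ℝ) 1 from mem_of_superset hmem hξI) ?_
    intro z hz hcl
    by_contra hne
    have hlt := pow_mul_pow_lt_max hl hm hz.1 hz.2 hne
    obtain ⟨U, hU, hU0⟩ := mapClusterPt_iff_ultrafilter.1 hcl
    have h1 : Tendsto (fun s => w s ^ 2) U (𝓝 (φ z)) := by
      refine (hφc.continuousAt.tendsto.comp hU0).congr' ?_
      filter_upwards [hU hmem] with s hs using (hwφ s hs).symm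
    have h2 := (hwlim.mono_left hU).pow 2
    rw [Real.sq_sqrt hcpos.le] at h2
    exact hlt.ne (tendsto_nhds_unique h1 h2)
  have hη2 : Tendsto (fun s => η s ^ 2) (𝓝[<] b) (𝓝 (m / (l + m))) := by
    have h1 := hξ2.const_sub 1
    rw [show 1 - c = m / (l + m) by rw [hc]; field_simp; ring] at h1
    refine h1.congr' ?_
    filter_upwards [hmem] with s hs
    linarith [(hpol s hs).2.2.2.1]
  obtain ⟨P, hP, hPl⟩ := exists_tendsto_of_sq ha'
    (fun s hs => (hpol s hs).2.2.2.2.2.2.1.continuousAt.continuousWithinAt)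
    (fun s hs => (hpol s hs).2.1) hξ2
  obtain ⟨Q, hQ, hQl⟩ := exists_tendsto_of_sq ha'
    (fun s hs => (hpol s hs).2.2.2.2.2.2.2.1.continuousAt.continuousWithinAt)
    (fun s hs => (hpol s hs).2.2.1) hη2
  -- The tangent points inwards in the limit, opposite to the limiting direction (P, Q) of the
  -- position.
  refine ⟨?_, -P, -Q, by rw [neg_sq]; exact hP, by rw [neg_sq]; exact hQ, ?_, ?_⟩
  · filter_upwards [hmem] with s hs using ⟨(hap s hs).1, (hap s hs).2.1⟩
  · have h1 := (hPl.mul hClim).sub (hQl.mul hSlim)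
    rw [mul_zero, sub_zero, mul_neg_one] at h1
    refine h1.congr' ?_
    filter_upwards [hmem] with s hs
    have hu := (hpol s hs).2.2.2.1
    simp only [hC, hS]
    linear_combination (p s) * hu
  · have h1 := (hQl.mul hClim).add (hPl.mul hSlim)
    rw [mul_zero, add_zero, mul_neg_one] at h1
    refine h1.congr' ?_
    filter_upwards [hmem] with s hs
    have hu := (hpol s hs).2.2.2.1
    simp only [hC, hS]
    linear_combination (q s) * hu

/-! ### The singular fixed point problem -/

/-- The gain 1/(k + 1) turns a Lipschitz constant below k + 1 into a contraction; the case k = 1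
gives the s²/2 in the estimate of the coordinates. -/
theorem abs_integral_pow_mul_le {k : ℕ} {h : ℝ → ℝ} {s B : ℝ} (hs : 0 ≤ s)
    (hB : ∀ τ ∈ Ioc 0 s, |h τ| ≤ B) :
    |∫ τ in (0 : ℝ)..s, τ ^ k * h τ| ≤ B * (s ^ (k + 1) / (k + 1)) := by
  have h1 : ‖∫ τ in (0 : ℝ)..s, τ ^ k * h τ‖ ≤ ∫ τ in (0 : ℝ)..s, τ ^ k * B := by
    refine intervalIntegral.norm_integral_le_of_norm_le hs (Eventually.of_forall fun τ hτ => ?_)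
      (by apply Continuous.intervalIntegrable; fun_prop)
    rw [Real.norm_eq_abs, abs_mul, abs_of_nonneg (pow_nonneg hτ.1.le k)]
    exact mul_le_mul_of_nonneg_left (hB τ hτ) (pow_nonneg hτ.1.le k)
  rw [intervalIntegral.integral_mul_const, integral_pow, zero_pow (Nat.succ_ne_zero k), sub_zero,
    mul_comm] at h1
  exact h1

/-- The singular equation `(s ζ)' + k ζ = g[ζ]` has a bounded solution when the functional `g` has
Lipschitz constant less than `k + 1` in the supremum norm: solutions are the fixed points of
`ζ ↦ s⁻⁽ᵏ⁺¹⁾ ∫₀ˢ τᵏ g[ζ](τ) dτ`. -/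
theorem exists_singular_fixedPoint (k : ℕ) {δ M : ℝ} (hδ : 0 < δ) (hM : 0 < M)
    (g : (ℝ → ℝ) → ℝ → ℝ)
    (hcont : ∀ ζ, ContinuousOn ζ (Ioi 0) → (∀ s, |ζ s| ≤ 2 * M) → ContinuousOn (g ζ) (Ioc 0 δ))
    (hlip : ∀ ζ₁ ζ₂ D, ContinuousOn ζ₁ (Ioi 0) → (∀ s, |ζ₁ s| ≤ 2 * M) →
      ContinuousOn ζ₂ (Ioi 0) → (∀ s, |ζ₂ s| ≤ 2 * M) → (∀ s, |ζ₁ s - ζ₂ s| ≤ D) →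
      ∀ s ∈ Ioc 0 δ, |g ζ₁ s - g ζ₂ s| ≤ (k + 1 / 2) * D)
    (h0 : ∀ s ∈ Ioc 0 δ, |g (fun _ => 0) s| ≤ M) :
    ∃ ζ, ContinuousOn ζ (Ioi 0) ∧ (∀ s, |ζ s| ≤ 2 * M) ∧
      ∀ s ∈ Ioo 0 δ, HasDerivAt (fun s => s * ζ s) (g ζ s - k * ζ s) s := by
  -- Clipping to [-2M, 2M] lets the contraction act on the whole Banach space although `g` is
  -- controlled only on this range.
  set cl : ℝ → ℝ := fun x => max (-(2 * M)) (min x (2 * M)) with hcl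
  have hcl_cont : Continuous cl := by fun_prop
  have hcl_abs : ∀ x, |cl x| ≤ 2 * M := fun x => by
    rw [abs_le]
    exact ⟨le_max_left _ _, max_le (by linarith) (min_le_right _ _)⟩
  have hcl_id : ∀ x, |x| ≤ 2 * M → cl x = x := fun x hx => by
    rw [abs_le] at hx
    simp only [hcl, min_eq_left hx.2, max_eq_right hx.1]
  have hcl_lip : ∀ x y, |cl x - cl y| ≤ |x - y| := fun x y => by
    have := ((LipschitzWith.id.min_const (2 * M)).const_max (-(2 * M))).dist_le_mul x y
    simpa [Real.dist_eq] using this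
  -- Logarithmic time s = exp t allows ζ to be discontinuous at 0. The values for s ≤ 0 are
  -- irrelevant but bounded.
  let Z : BoundedContinuousFunction ℝ ℝ → ℝ → ℝ := fun u s => cl (u (Real.log s))
  have hZc : ∀ u, ContinuousOn (Z u) (Ioi 0) := fun u =>
    hcl_cont.comp_continuousOn (u.continuous.comp_continuousOn
      (Real.continuousOn_log.mono fun s hs => ne_of_gt hs))
  have hZb : ∀ u s, |Z u s| ≤ 2 * M := fun u s => hcl_abs _
  have hgb : ∀ u, ∀ s ∈ Ioc 0 δ, |g (Z u) s| ≤ M + (k + 1 / 2) * (2 * M) := by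
    intro u s hs
    have h1 := hlip (Z u) (fun _ => 0) (2 * M) (hZc u) (hZb u) continuousOn_const
      (fun s => by simp; linarith) (fun s => by simpa using hZb u s) s hs
    have h2 := h0 s hs
    have := abs_sub_abs_le_abs_sub (g (Z u) s) (g (fun _ => 0) s)
    linarith
  have hint : ∀ u, MeasureTheory.IntegrableOn (fun τ => τ ^ k * g (Z u) τ) (Icc 0 δ) := by
    intro u
    rw [integrableOn_Icc_iff_integrableOn_Ioc]
    refine MeasureTheory.Integrable.of_bound ?_ (δ ^ k * (M + (k + 1 / 2) * (2 * M))) ?_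
    · exact ((continuousOn_id.pow k).mul (hcont _ (hZc u) (hZb u))).aestronglyMeasurable
        measurableSet_Ioc
    · refine (MeasureTheory.ae_restrict_iff' measurableSet_Ioc).2
        (Eventually.of_forall fun s hs => ?_)
      rw [Real.norm_eq_abs, abs_mul, abs_of_nonneg (pow_nonneg hs.1.le k)]
      have := hs.1.le
      gcongr
      · exact hs.2
      · exact hgb u s hs
  have hprim : ∀ u, ContinuousOn (fun s => ∫ τ in (0 : ℝ)..s, τ ^ k * g (Z u) τ) (Icc 0 δ) := by
    intro u
    have := intervalIntegral.continuousOn_primitive_interval (a := 0) (b := δ)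
      (f := fun τ => τ ^ k * g (Z u) τ) (μ := MeasureTheory.volume)
      (by rw [uIcc_of_le hδ.le]; exact hint u)
    rwa [uIcc_of_le hδ.le] at this
  have hintI : ∀ u, ∀ s ∈ Ioc 0 δ, IntervalIntegrable (fun τ => τ ^ k * g (Z u) τ)
      MeasureTheory.volume 0 s := by
    intro u s hs
    rw [intervalIntegrable_iff_integrableOn_Icc_of_le hs.1.le]
    exact (hint u).mono_set (Icc_subset_Icc_right hs.2)
  let σ : ℝ → ℝ := fun t => min (Real.exp t) δ
  have hσ : ∀ t, σ t ∈ Ioc 0 δ := fun t => ⟨lt_min (Real.exp_pos t) hδ, min_le_right _ _⟩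
  have hσc : Continuous σ := Real.continuous_exp.min continuous_const
  have hkpos : (0 : ℝ) < k + 1 := by positivity
  have hTb : ∀ (h : ℝ → ℝ) (B : ℝ), (∀ s ∈ Ioc 0 δ, |h s| ≤ B) → ∀ t,
      |(σ t ^ (k + 1))⁻¹ * ∫ τ in (0 : ℝ)..σ t, τ ^ k * h τ| ≤ B / (k + 1) := by
    intro h B hB t
    have hpos : 0 < σ t ^ (k + 1) := pow_pos (hσ t).1 _
    rw [abs_mul, abs_of_pos (inv_pos.2 hpos), inv_mul_le_iff₀ hpos]
    refine (abs_integral_pow_mul_le (hσ t).1.le fun τ hτ =>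
      hB τ ⟨hτ.1, hτ.2.trans (hσ t).2⟩).trans (le_of_eq ?_)
    ring
  let T : BoundedContinuousFunction ℝ ℝ → BoundedContinuousFunction ℝ ℝ := fun u =>
    BoundedContinuousFunction.ofNormedAddCommGroup
      (fun t => (σ t ^ (k + 1))⁻¹ * ∫ τ in (0 : ℝ)..σ t, τ ^ k * g (Z u) τ)
      (by
        refine Continuous.mul ((hσc.pow _).inv₀ fun t => (pow_pos (hσ t).1 _).ne') ?_
        exact (hprim u).comp_continuous hσc fun t => Ioc_subset_Icc_self (hσ t))
      ((M + (k + 1 / 2) * (2 * M)) / (k + 1)) (fun t => hTb _ _ (hgb u) t)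
  have hTa : ∀ u t, T u t = (σ t ^ (k + 1))⁻¹ * ∫ τ in (0 : ℝ)..σ t, τ ^ k * g (Z u) τ :=
    fun u t => rfl
  let κ : NNReal := ⟨(k + 1 / 2) / (k + 1), by positivity⟩
  have hκ : (κ : ℝ) = (k + 1 / 2) / (k + 1) := rfl
  have hT : ContractingWith κ T := by
    refine ⟨?_, LipschitzWith.of_dist_le_mul fun u v => ?_⟩
    · rw [← NNReal.coe_lt_coe, hκ, NNReal.coe_one, div_lt_one hkpos]; linarith
    · rw [BoundedContinuousFunction.dist_le (by positivity)]
      intro t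
      rw [Real.dist_eq, hTa, hTa, ← mul_sub, ← intervalIntegral.integral_sub (hintI u _ (hσ t))
        (hintI v _ (hσ t))]
      simp_rw [← mul_sub]
      have h1 : ∀ s ∈ Ioc 0 δ, |g (Z u) s - g (Z v) s| ≤ (k + 1 / 2) * dist u v :=
        hlip _ _ _ (hZc u) (hZb u) (hZc v) (hZb v) fun s =>
          (hcl_lip _ _).trans (BoundedContinuousFunction.dist_coe_le_dist (f := u) (g := v) _)
      refine (hTb (fun τ => g (Z u) τ - g (Z v) τ) _ h1 t).trans (le_of_eq ?_)
      rw [hκ]; ring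
  set u := hT.fixedPoint T with hu
  have hfix : T u = u := hT.fixedPoint_isFixedPt
  -- The a priori bound (M/(k + 1)) / (1 - κ) with 1 - κ = (1/2)/(k + 1) equals 2M, so the clipping
  -- is inactive at the fixed point.
  have hub : ∀ t, |u t| ≤ 2 * M := by
    intro t
    have h1 := hT.dist_fixedPoint_le 0
    have h2 : dist 0 (T 0) ≤ M / (k + 1) := by
      rw [BoundedContinuousFunction.dist_le (by positivity)]
      intro t
      have hZ0 : Z 0 = fun _ => 0 := by
        funext s
        exact hcl_id 0 (by simp; linarith)
      rw [Real.dist_eq, BoundedContinuousFunction.coe_zero, Pi.zero_apply, zero_sub, abs_neg, hTa,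
        hZ0]
      exact hTb _ _ h0 t
    have h3 : (1 : ℝ) - κ = 1 / 2 / (k + 1) := by rw [hκ]; field_simp; ring
    have h4 : |u t| ≤ dist 0 u := by
      have := BoundedContinuousFunction.dist_coe_le_dist (f := 0) (g := u) t
      simpa [Real.dist_eq] using this
    refine h4.trans (h1.trans ?_)
    rw [h3, div_le_iff₀ (by positivity)]
    refine h2.trans (le_of_eq ?_)
    field_simp
  have hZu : ∀ s, Z u s = u (Real.log s) := fun s => hcl_id _ (hub _)
  have heq : ∀ s ∈ Ioc 0 δ, s ^ (k + 1) * Z u s = ∫ τ in (0 : ℝ)..s, τ ^ k * g (Z u) τ := by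
    intro s hs
    have hσs : σ (Real.log s) = s := by
      simp only [σ, Real.exp_log hs.1, min_eq_left hs.2]
    rw [hZu, ← hfix, hTa, hσs, hfix]
    have : s ^ (k + 1) ≠ 0 := (pow_pos hs.1 _).ne'
    field_simp
  refine ⟨Z u, hZc u, hZb u, fun s hs => ?_⟩
  have hco : ContinuousOn (fun τ => τ ^ k * g (Z u) τ) (Ioo 0 δ) :=
    ((continuousOn_id.pow k).mul (hcont _ (hZc u) (hZb u))).mono Ioo_subset_Ioc_self
  have hI : HasDerivAt (fun v => ∫ τ in (0 : ℝ)..v, τ ^ k * g (Z u) τ) (s ^ k * g (Z u) s) s :=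
    intervalIntegral.integral_hasDerivAt_right (hintI u s (Ioo_subset_Ioc_self hs))
      (hco.stronglyMeasurableAtFilter isOpen_Ioo _ hs) (hco.continuousAt (Ioo_mem_nhds hs.1 hs.2))
  have hpow : s ^ k ≠ 0 := pow_ne_zero _ hs.1.ne'
  have h1 : HasDerivAt (fun v => (∫ τ in (0 : ℝ)..v, τ ^ k * g (Z u) τ) / v ^ k)
      (g (Z u) s - k * Z u s) s := by
    refine (hI.div ((hasDerivAt_id s).fun_pow k) hpow).congr_deriv ?_
    rw [← heq s (Ioo_subset_Ioc_self hs)]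
    have := hs.1.ne'
    rcases k with _ | j
    · simp
    · simp only [id, Nat.add_sub_cancel]
      field_simp
      ring
  refine h1.congr_of_eventuallyEq ?_
  filter_upwards [Ioo_mem_nhds hs.1 hs.2] with v hv
  rw [← heq v (Ioo_subset_Ioc_self hv), eq_div_iff (pow_ne_zero _ hv.1.ne')]
  ring

/-! ### Dependence of the coordinates and of the curvature on ζ -/

/-- The coordinate reached at time `s` by a curve with angle `θ₀ + s ζ(s)` starting at `Y`. -/
noncomputable def sinPrimitive (θ₀ Y : ℝ) (ζ : ℝ → ℝ) (s : ℝ) : ℝ :=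
  Y + ∫ τ in (0 : ℝ)..s, Real.sin (θ₀ + τ * ζ τ)

section SinPrimitive

variable {θ₀ Y R : ℝ} {ζ ζ₁ ζ₂ : ℝ → ℝ}

theorem continuousOn_id_mul (hc : ContinuousOn ζ (Ioi 0)) (hb : ∀ s, |ζ s| ≤ R) :
    ContinuousOn (fun s => s * ζ s) (Ici 0) := by
  intro s hs
  rcases eq_or_lt_of_le (mem_Ici.1 hs) with rfl | h
  · have : Tendsto (fun s => s * ζ s) (𝓝 0) (𝓝 0) := by
      refine squeeze_zero_norm (a := fun s => |s| * R) (fun s => ?_) ?_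
      · rw [Real.norm_eq_abs, abs_mul]; gcongr; exact hb s
      · have h1 : Continuous fun s : ℝ => |s| * R := by fun_prop
        simpa using h1.tendsto 0
    refine ContinuousAt.continuousWithinAt ?_
    simpa [ContinuousAt] using this
  · exact (continuousAt_id.mul (hc.continuousAt (Ioi_mem_nhds h))).continuousWithinAt

theorem continuousOn_sin_integrand (hc : ContinuousOn ζ (Ioi 0)) (hb : ∀ s, |ζ s| ≤ R) :
    ContinuousOn (fun s => Real.sin (θ₀ + s * ζ s)) (Ici 0) :=
  Real.continuous_sin.comp_continuousOn (continuousOn_const.add (continuousOn_id_mul hc hb))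

theorem intervalIntegrable_sin_integrand (hc : ContinuousOn ζ (Ioi 0)) (hb : ∀ s, |ζ s| ≤ R)
    {s : ℝ} (hs : 0 ≤ s) :
    IntervalIntegrable (fun s => Real.sin (θ₀ + s * ζ s)) MeasureTheory.volume 0 s := by
  refine ContinuousOn.intervalIntegrable ((continuousOn_sin_integrand hc hb).mono ?_)
  rw [uIcc_of_le hs]
  exact Icc_subset_Ici_self

theorem hasDerivAt_sinPrimitive (hc : ContinuousOn ζ (Ioi 0)) (hb : ∀ s, |ζ s| ≤ R) {s : ℝ}
    (hs : 0 < s) : HasDerivAt (sinPrimitive θ₀ Y ζ) (Real.sin (θ₀ + s * ζ s)) s := by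
  have hco := (continuousOn_sin_integrand (θ₀ := θ₀) hc hb)
  refine (intervalIntegral.integral_hasDerivAt_right
    (intervalIntegrable_sin_integrand hc hb hs.le) ?_ ?_).const_add Y
  · exact (hco.mono Ioi_subset_Ici_self).stronglyMeasurableAtFilter isOpen_Ioi _ hs
  · exact hco.continuousAt (Ici_mem_nhds hs)

theorem tendsto_sinPrimitive : Tendsto (sinPrimitive θ₀ Y ζ) (𝓝[>] 0) (𝓝 Y) := by
  have : Tendsto (fun s => ∫ τ in (0 : ℝ)..s, Real.sin (θ₀ + τ * ζ τ)) (𝓝[>] 0) (𝓝 0) := by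
    refine squeeze_zero_norm (a := fun s => |s|) (fun s => ?_) ?_
    · have := intervalIntegral.norm_integral_le_of_norm_le_const (a := 0) (b := s) (C := 1)
        (f := fun τ => Real.sin (θ₀ + τ * ζ τ)) fun τ _ => Real.abs_sin_le_one _
      simpa using this
    · exact (by simpa using (continuous_abs (G := ℝ)).tendsto 0 :
        Tendsto (fun s : ℝ => |s|) (𝓝 0) (𝓝 0)).mono_left nhdsWithin_le_nhds
  have h1 := this.const_add Y
  rwa [add_zero] at h1

theorem abs_sin_sub_sin_le (a b : ℝ) : |Real.sin a - Real.sin b| ≤ |a - b| := by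
  have := Convex.norm_image_sub_le_of_norm_hasDerivWithin_le (f := Real.sin) (f' := Real.cos)
    (s := univ) (C := 1) (fun x _ => (Real.hasDerivAt_sin x).hasDerivWithinAt)
    (fun x _ => Real.abs_cos_le_one x) convex_univ (mem_univ b) (mem_univ a)
  simpa using this

theorem abs_cos_sub_cos_le (a b : ℝ) : |Real.cos a - Real.cos b| ≤ |a - b| := by
  have := Convex.norm_image_sub_le_of_norm_hasDerivWithin_le (f := Real.cos)
    (f' := fun x => -Real.sin x)
    (s := univ) (C := 1) (fun x _ => (Real.hasDerivAt_cos x).hasDerivWithinAt)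
    (fun x _ => by simpa using Real.abs_sin_le_one x) convex_univ (mem_univ b) (mem_univ a)
  simpa using this

/-- The function cos t + t sin θ₀ has derivative at most ρ in size within distance ρ of θ₀. This
isolates the linear part of the cosine, which the term m ζ is added to cancel. -/
theorem abs_cos_sub_cos_add_le {a b ρ : ℝ} (ha : |a - θ₀| ≤ ρ) (hb : |b - θ₀| ≤ ρ) :
    |Real.cos a - Real.cos b + Real.sin θ₀ * (a - b)| ≤ ρ * |a - b| := by
  have := Convex.norm_image_sub_le_of_norm_hasDerivWithin_le
    (f := fun t => Real.cos t + Real.sin θ₀ * t)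
    (f' := fun t => -Real.sin t + Real.sin θ₀ * 1) (s := Icc (θ₀ - ρ) (θ₀ + ρ)) (C := ρ)
    (fun x _ => ((Real.hasDerivAt_cos x).add
      ((hasDerivAt_id x).const_mul (Real.sin θ₀))).hasDerivWithinAt)
    (fun x hx => by
      rw [Real.norm_eq_abs, show -Real.sin x + Real.sin θ₀ * 1 = Real.sin θ₀ - Real.sin x by ring]
      refine (abs_sin_sub_sin_le _ _).trans ?_
      rw [abs_le]; constructor <;> linarith [hx.1, hx.2]) (convex_Icc _ _)
    (x := b) (y := a) ⟨by linarith [(abs_le.1 hb).1], by linarith [(abs_le.1 hb).2]⟩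
    ⟨by linarith [(abs_le.1 ha).1], by linarith [(abs_le.1 ha).2]⟩
  rw [Real.norm_eq_abs, Real.norm_eq_abs] at this
  convert this using 2
  ring

/-- At time τ the angles differ by at most D τ, so the coordinates differ to second order in s.
Against the denominators, of order s² for a curve leaving the axis, this leaves a finite constant.
-/
theorem abs_sinPrimitive_sub_le {D : ℝ} (hc₁ : ContinuousOn ζ₁ (Ioi 0)) (hb₁ : ∀ s, |ζ₁ s| ≤ R)
    (hc₂ : ContinuousOn ζ₂ (Ioi 0)) (hb₂ : ∀ s, |ζ₂ s| ≤ R) (hD : ∀ s, |ζ₁ s - ζ₂ s| ≤ D) {s : ℝ}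
    (hs : 0 < s) : |sinPrimitive θ₀ Y ζ₁ s - sinPrimitive θ₀ Y ζ₂ s| ≤ D * (s ^ 2 / 2) := by
  have e : sinPrimitive θ₀ Y ζ₁ s - sinPrimitive θ₀ Y ζ₂ s = ∫ τ in (0 : ℝ)..s,
      τ ^ 1 * ((Real.sin (θ₀ + τ * ζ₁ τ) - Real.sin (θ₀ + τ * ζ₂ τ)) / τ) := by
    rw [sinPrimitive, sinPrimitive, add_sub_add_left_eq_sub, ← intervalIntegral.integral_sub
      (intervalIntegrable_sin_integrand hc₁ hb₁ hs.le)
      (intervalIntegrable_sin_integrand hc₂ hb₂ hs.le)]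
    refine intervalIntegral.integral_congr fun τ _ => ?_
    rcases eq_or_ne τ 0 with rfl | h
    · simp
    · field_simp
  rw [e]
  refine (abs_integral_pow_mul_le (B := D) hs.le fun τ hτ => ?_).trans (le_of_eq ?_)
  · rw [abs_div, div_le_iff₀ (abs_pos.2 hτ.1.ne')]
    refine (abs_sin_sub_sin_le _ _).trans ?_
    rw [show θ₀ + τ * ζ₁ τ - (θ₀ + τ * ζ₂ τ) = (ζ₁ τ - ζ₂ τ) * τ by ring, abs_mul]
    gcongr
    exact hD τ
  · norm_num

theorem sinPrimitive_zero (s : ℝ) : sinPrimitive θ₀ Y (fun _ => 0) s = Y + s * Real.sin θ₀ := by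
  simp [sinPrimitive]

/-- Lipschitz estimate for one singular term `m cos θ / y` of the curvature, corrected by its
linear part `- m ζ` when the curve starts on the axis. -/
theorem exists_lipschitz_singular_term (m : ℕ) {ε : ℝ} (hY : Y = 0 → Real.sin θ₀ ≠ 0)
    (hε : 0 < ε) (hR : 0 < R) :
    ∀ᶠ s in 𝓝[>] (0 : ℝ), ∀ ζ₁, ContinuousOn ζ₁ (Ioi 0) → (∀ s, |ζ₁ s| ≤ R) →
      sinPrimitive θ₀ Y ζ₁ s ≠ 0 ∧
      ∀ ζ₂, ContinuousOn ζ₂ (Ioi 0) → (∀ s, |ζ₂ s| ≤ R) → ∀ D, (∀ s, |ζ₁ s - ζ₂ s| ≤ D) →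
        |(m * (Real.cos (θ₀ + s * ζ₁ s) / sinPrimitive θ₀ Y ζ₁ s) + (if Y = 0 then m else 0) * ζ₁ s)
          - (m * (Real.cos (θ₀ + s * ζ₂ s) / sinPrimitive θ₀ Y ζ₂ s)
            + (if Y = 0 then m else 0) * ζ₂ s)|
        ≤ ((if Y = 0 then m * |Real.cos θ₀| / (2 * Real.sin θ₀ ^ 2) else 0) + ε) * D := by
  have hpos : ∀ᶠ s in 𝓝[>] (0 : ℝ), 0 < s := self_mem_nhdsWithin
  have hsmall : ∀ (φ : ℝ → ℝ) (c : ℝ), ContinuousAt φ 0 → φ 0 < c →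
      ∀ᶠ s in 𝓝[>] (0 : ℝ), φ s < c := fun φ c h1 h2 =>
    (h1.eventually_lt_const h2).filter_mono nhdsWithin_le_nhds
  have hdist : ∀ ζ, ContinuousOn ζ (Ioi 0) → (∀ s, |ζ s| ≤ R) → ∀ s, 0 < s →
      |sinPrimitive θ₀ Y ζ s - (Y + s * Real.sin θ₀)| ≤ R * (s ^ 2 / 2) := by
    intro ζ hc hb s hs
    have := abs_sinPrimitive_sub_le (θ₀ := θ₀) (Y := Y) hc hb (ζ₂ := fun _ => 0) continuousOn_const
      (fun s => by simpa using hR.le) (fun s => by simpa using hb s) hs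
    rwa [sinPrimitive_zero] at this
  by_cases h0 : Y = 0
  · simp only [h0, if_true]
    subst h0
    set P := Real.cos θ₀ with hP
    set Q := Real.sin θ₀ with hQ
    have hQ0 : 0 < |Q| := abs_pos.2 (hY rfl)
    have ev1 := hsmall (fun s => R * s) |Q| (by fun_prop) (by simpa using hQ0)
    have ev2 := hsmall (fun s => m * (3 * R * s / |Q|)) (ε / 2) (by fun_prop)
      (by simpa using hε)
    have ev3 := hsmall (fun s => m * ((|P| + R * s) / (2 * (|Q| - R * s / 2) ^ 2)))
      (m * |P| / (2 * Q ^ 2) + ε / 2) (by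
        refine ContinuousAt.mul continuousAt_const (ContinuousAt.div (by fun_prop) (by fun_prop) ?_)
        simpa using hY rfl) (by
        simp only [mul_zero, zero_div, sub_zero, add_zero, sq_abs]
        rw [mul_div_assoc]; linarith)
    filter_upwards [hpos, ev1, ev2, ev3] with s hs h1 h2 h3 ζ₁ hc₁ hb₁
    have hlow : ∀ ζ, ContinuousOn ζ (Ioi 0) → (∀ s, |ζ s| ≤ R) →
        (|Q| - R * s / 2) * s ≤ |sinPrimitive θ₀ 0 ζ s| := by
      intro ζ hc hb
      have h4 := hdist ζ hc hb s hs
      rw [zero_add] at h4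
      have h5 := abs_sub_abs_le_abs_sub (s * Q) (sinPrimitive θ₀ 0 ζ s)
      rw [abs_sub_comm (s * Q), abs_mul, abs_of_pos hs] at h5
      nlinarith
    have hlowpos : 0 < |Q| - R * s / 2 := by nlinarith
    have hy₁ := hlow ζ₁ hc₁ hb₁
    have hy₁pos : 0 < |sinPrimitive θ₀ 0 ζ₁ s| := (mul_pos hlowpos hs).trans_le hy₁
    refine ⟨abs_pos.1 hy₁pos, fun ζ₂ hc₂ hb₂ D hD => ?_⟩
    have hy₂ := hlow ζ₂ hc₂ hb₂
    have hy₂pos : 0 < |sinPrimitive θ₀ 0 ζ₂ s| := (mul_pos hlowpos hs).trans_le hy₂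
    have hD0 : 0 ≤ D := (abs_nonneg _).trans (hD 0)
    have hdy := abs_sinPrimitive_sub_le (θ₀ := θ₀) (Y := 0) hc₁ hb₁ hc₂ hb₂ hD hs
    have hd1 := hdist ζ₁ hc₁ hb₁ s hs
    rw [zero_add] at hd1
    set y₁ := sinPrimitive θ₀ 0 ζ₁ s
    set y₂ := sinPrimitive θ₀ 0 ζ₂ s
    have hy₁0 : y₁ ≠ 0 := abs_pos.1 hy₁pos
    have hy₂0 : y₂ ≠ 0 := abs_pos.1 hy₂pos
    set a₁ := θ₀ + s * ζ₁ s with ha₁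
    set a₂ := θ₀ + s * ζ₂ s with ha₂
    have hda : a₁ - a₂ = s * (ζ₁ s - ζ₂ s) := by rw [ha₁, ha₂]; ring
    have hada : |a₁ - a₂| ≤ s * D := by
      rw [hda, abs_mul, abs_of_pos hs]; gcongr; exact hD s
    have hnear : ∀ z, |z| ≤ R → |θ₀ + s * z - θ₀| ≤ R * s := fun z hz => by
      rw [add_sub_cancel_left, abs_mul, abs_of_pos hs, mul_comm]; gcongr
    -- The first summand has its linear part removed, so its Lipschitz constant is O(s). The second
    -- comes from varying the denominator and yields the constant m |P| / (2 Q²).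
    have e : m * (Real.cos a₁ / y₁) + m * ζ₁ s - (m * (Real.cos a₂ / y₂) + m * ζ₂ s)
        = m * ((s * (Real.cos a₁ - Real.cos a₂ + Q * (a₁ - a₂)) + (y₁ - s * Q) * (a₁ - a₂))
            / (s * y₁)) + m * (Real.cos a₂ * (y₂ - y₁) / (y₁ * y₂)) := by
      rw [hda]; field_simp; ring
    have t1 : |(s * (Real.cos a₁ - Real.cos a₂ + Q * (a₁ - a₂)) + (y₁ - s * Q) * (a₁ - a₂))
            / (s * y₁)| ≤ 3 * R * s / |Q| * D := by
      rw [abs_div, abs_mul s y₁, abs_of_pos hs, div_le_iff₀ (mul_pos hs hy₁pos)]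
      have n1 : |s * (Real.cos a₁ - Real.cos a₂ + Q * (a₁ - a₂)) + (y₁ - s * Q) * (a₁ - a₂)|
          ≤ s * (R * s * (s * D)) + R * (s ^ 2 / 2) * (s * D) := by
        refine (abs_add_le _ _).trans (add_le_add ?_ ?_)
        · rw [abs_mul, abs_of_pos hs]
          gcongr
          refine (abs_cos_sub_cos_add_le (hnear _ (hb₁ s)) (hnear _ (hb₂ s))).trans ?_
          gcongr
        · rw [abs_mul]; gcongr
      refine n1.trans ?_
      have n2 : |Q| / 2 * s ≤ |y₁| := le_trans (by gcongr; nlinarith) hy₁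
      calc s * (R * s * (s * D)) + R * (s ^ 2 / 2) * (s * D)
          = 3 * R * s / |Q| * D * (s * (|Q| / 2 * s)) := by field_simp; ring
        _ ≤ _ := by gcongr
    have t2 : |Real.cos a₂ * (y₂ - y₁) / (y₁ * y₂)|
        ≤ (|P| + R * s) / (2 * (|Q| - R * s / 2) ^ 2) * D := by
      have n1 : |Real.cos a₂| ≤ |P| + R * s := by
        have := (abs_sub_abs_le_abs_sub _ _).trans
          ((abs_cos_sub_cos_le a₂ θ₀).trans (hnear _ (hb₂ s)))
        linarith
      rw [abs_div, abs_mul, abs_mul, abs_sub_comm y₂]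
      calc |Real.cos a₂| * |y₁ - y₂| / (|y₁| * |y₂|)
          ≤ (|P| + R * s) * (D * (s ^ 2 / 2))
            / (((|Q| - R * s / 2) * s) * ((|Q| - R * s / 2) * s)) := by gcongr
        _ = _ := by field_simp
    rw [e]
    calc _ ≤ |(m : ℝ) * ((s * (Real.cos a₁ - Real.cos a₂ + Q * (a₁ - a₂))
            + (y₁ - s * Q) * (a₁ - a₂)) / (s * y₁))|
            + |(m : ℝ) * (Real.cos a₂ * (y₂ - y₁) / (y₁ * y₂))| := abs_add_le _ _
      _ ≤ m * (3 * R * s / |Q| * D) + m * ((|P| + R * s) / (2 * (|Q| - R * s / 2) ^ 2) * D) := by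
          rw [abs_mul, abs_mul, Nat.abs_cast]; gcongr
      _ = (m * (3 * R * s / |Q|) + m * ((|P| + R * s) / (2 * (|Q| - R * s / 2) ^ 2))) * D := by
          ring
      _ ≤ _ := by
          refine mul_le_mul_of_nonneg_right ?_ hD0
          linarith
  -- Off the axis the denominator stays away from 0 and the Lipschitz constant tends to 0 with s.
  · simp only [h0, if_false, Nat.cast_zero, zero_mul, add_zero, zero_add]
    have hY0 : 0 < |Y| := abs_pos.2 h0
    have ev1 := hsmall (fun s => s + R * (s ^ 2 / 2)) (|Y| / 2) (by fun_prop)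
      (by simpa using hY0)
    have ev2 := hsmall (fun s => m * (s * (2 / |Y|) + s ^ 2 / 2 * (4 / |Y| ^ 2))) ε (by fun_prop)
      (by simpa using hε)
    filter_upwards [hpos, ev1, ev2] with s hs h1 h2 ζ₁ hc₁ hb₁
    have hlow : ∀ ζ, ContinuousOn ζ (Ioi 0) → (∀ s, |ζ s| ≤ R) →
        |Y| / 2 ≤ |sinPrimitive θ₀ Y ζ s| := by
      intro ζ hc hb
      have h4 := hdist ζ hc hb s hs
      have h5 := abs_sub_abs_le_abs_sub Y (Y - sinPrimitive θ₀ Y ζ s)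
      rw [sub_sub_cancel] at h5
      have h6 : |Y - sinPrimitive θ₀ Y ζ s| ≤ R * (s ^ 2 / 2) + s := by
        have : Y - sinPrimitive θ₀ Y ζ s
            = -(sinPrimitive θ₀ Y ζ s - (Y + s * Real.sin θ₀)) + -(s * Real.sin θ₀) := by ring
        rw [this]
        refine (abs_add_le _ _).trans (add_le_add (by rwa [abs_neg]) ?_)
        rw [abs_neg, abs_mul, abs_of_pos hs]
        exact mul_le_of_le_one_right hs.le (Real.abs_sin_le_one _)
      linarith
    have hy₁ := hlow ζ₁ hc₁ hb₁
    have hy₁pos : 0 < |sinPrimitive θ₀ Y ζ₁ s| := (half_pos hY0).trans_le hy₁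
    refine ⟨abs_pos.1 hy₁pos, fun ζ₂ hc₂ hb₂ D hD => ?_⟩
    have hy₂ := hlow ζ₂ hc₂ hb₂
    have hy₂pos : 0 < |sinPrimitive θ₀ Y ζ₂ s| := (half_pos hY0).trans_le hy₂
    have hD0 : 0 ≤ D := (abs_nonneg _).trans (hD 0)
    have hdy := abs_sinPrimitive_sub_le (θ₀ := θ₀) (Y := Y) hc₁ hb₁ hc₂ hb₂ hD hs
    set y₁ := sinPrimitive θ₀ Y ζ₁ s
    set y₂ := sinPrimitive θ₀ Y ζ₂ s
    have hy₁0 : y₁ ≠ 0 := abs_pos.1 hy₁pos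
    have hy₂0 : y₂ ≠ 0 := abs_pos.1 hy₂pos
    have hada : |Real.cos (θ₀ + s * ζ₁ s) - Real.cos (θ₀ + s * ζ₂ s)| ≤ s * D := by
      refine (abs_cos_sub_cos_le _ _).trans ?_
      rw [add_sub_add_left_eq_sub, ← mul_sub, abs_mul, abs_of_pos hs]; gcongr; exact hD s
    set c₁ := Real.cos (θ₀ + s * ζ₁ s)
    have hc₂1 := Real.abs_cos_le_one (θ₀ + s * ζ₂ s)
    set c₂ := Real.cos (θ₀ + s * ζ₂ s)
    have e : m * (c₁ / y₁) - m * (c₂ / y₂)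
        = m * ((c₁ - c₂) / y₁ + c₂ * (y₂ - y₁) / (y₁ * y₂)) := by field_simp; ring
    rw [e, abs_mul, Nat.abs_cast]
    calc m * |(c₁ - c₂) / y₁ + c₂ * (y₂ - y₁) / (y₁ * y₂)|
        ≤ m * (|c₁ - c₂| / |y₁| + |c₂| * |y₁ - y₂| / (|y₁| * |y₂|)) := by
          gcongr
          refine (abs_add_le _ _).trans (le_of_eq ?_)
          rw [abs_div, abs_div, abs_mul, abs_mul, abs_sub_comm y₂]
      _ ≤ m * (s * D / (|Y| / 2) + 1 * (D * (s ^ 2 / 2)) / (|Y| / 2 * (|Y| / 2))) := by gcongr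
      _ = (m * (s * (2 / |Y|) + s ^ 2 / 2 * (4 / |Y| ^ 2))) * D := by field_simp; ring
      _ ≤ ε * D := mul_le_mul_of_nonneg_right h2.le hD0

end SinPrimitive

/-! ### Departure from an admissible point -/

theorem exists_angle {P Q : ℝ} (h : P ^ 2 + Q ^ 2 = 1) :
    ∃ θ : ℝ, Real.cos θ = P ∧ Real.sin θ = Q := by
  have hn : ‖(⟨P, Q⟩ : ℂ)‖ = 1 := by
    rw [Complex.norm_def, Complex.normSq_mk, ← sq, ← sq, h, Real.sqrt_one]
  have h0 : (⟨P, Q⟩ : ℂ) ≠ 0 := by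
    intro h0; rw [h0, norm_zero] at hn; exact zero_ne_one hn
  refine ⟨Complex.arg ⟨P, Q⟩, ?_, ?_⟩
  · rw [Complex.cos_arg h0, hn, div_one]
  · rw [Complex.sin_arg, hn, div_one]

section Admissible

variable {l m : ℕ} {X Y P Q : ℝ}

theorem Admissible.ne_zero_of_y (hm : 1 ≤ m) (h : Admissible l m X Y P Q) (hY : Y = 0) : Q ≠ 0 := by
  intro hQ
  have hu := h.unit
  by_cases hX : X = 0
  · have := (h.cross_origin hX hY).2
    rw [hQ] at this
    have hmR : (0 : ℝ) < m := by exact_mod_cast hm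
    have : (0 : ℝ) < m / (l + m) := by positivity
    linarith
  · rw [h.cross_x hY hX, hQ] at hu; norm_num at hu

theorem Admissible.ne_zero_of_x (hl : 1 ≤ l) (h : Admissible l m X Y P Q) (hX : X = 0) : P ≠ 0 :=
  h.swap.ne_zero_of_y hl hX

/-- The Lipschitz constant of the singular part of the curvature is at most its weight. -/
theorem Admissible.lipschitz_const_le (hl : 1 ≤ l) (hm : 1 ≤ m) (h : Admissible l m X Y P Q) :
    (if Y = 0 then m * |P| / (2 * Q ^ 2) else 0) + (if X = 0 then l * |Q| / (2 * P ^ 2) else 0)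
      ≤ (((if Y = 0 then m else 0) + (if X = 0 then l else 0) : ℕ) : ℝ) := by
  have hmR : (0 : ℝ) < m := by exact_mod_cast hm
  have hlR : (0 : ℝ) < l := by exact_mod_cast hl
  by_cases hY : Y = 0 <;> by_cases hX : X = 0
  · simp only [hY, hX, if_true]
    obtain ⟨h1, h2⟩ := h.cross_origin hX hY
    have hP := h.abs_le.1
    have hQ := h.abs_le.2
    rw [h1, h2]
    -- At the origin the prescribed Q² and P² make the sum (l + m)/2 (|P| + |Q|), at most l + m.
    have e1 : (m : ℝ) * |P| / (2 * (m / (l + m))) = (l + m) / 2 * |P| := by field_simp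
    have e2 : (l : ℝ) * |Q| / (2 * (l / (l + m))) = (l + m) / 2 * |Q| := by field_simp
    rw [e1, e2]
    push_cast
    nlinarith
  · simp [hY, hX, h.cross_x hY hX]
  · simp [hY, hX, h.cross_y hX hY]
  · simp [hY, hX]

/-- The prescribed curvature stays bounded along the straight line leaving an admissible point. -/
theorem Admissible.exists_tendsto_line (hl : 1 ≤ l) (hm : 1 ≤ m) (h : Admissible l m X Y P Q) :
    ∃ c, Tendsto (fun s : ℝ => m * (P / (Y + s * Q)) - l * (Q / (X + s * P))) (𝓝[>] 0) (𝓝 c) := by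
  have hmR : (0 : ℝ) < m := by exact_mod_cast hm
  have hlR : (0 : ℝ) < l := by exact_mod_cast hl
  have aux : ∀ A B C : ℝ, A ≠ 0 → Tendsto (fun s : ℝ => C / (A + s * B)) (𝓝[>] 0) (𝓝 (C / A)) := by
    intro A B C hA
    have : ContinuousAt (fun s : ℝ => C / (A + s * B)) 0 :=
      ContinuousAt.div (by fun_prop) (by fun_prop) (by simpa using hA)
    have h2 := this.tendsto
    simp only [zero_mul, add_zero] at h2
    exact h2.mono_left nhdsWithin_le_nhds
  by_cases hY : Y = 0 <;> by_cases hX : X = 0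
  · refine ⟨0, tendsto_const_nhds.congr' ?_⟩
    obtain ⟨h1, h2⟩ := h.cross_origin hX hY
    have hP := h.ne_zero_of_x hl hX
    have hQ := h.ne_zero_of_y hm hY
    filter_upwards [self_mem_nhdsWithin] with s hs
    have hs' : s ≠ 0 := ne_of_gt hs
    -- In the prescribed directions at the origin the two 1/s singularities cancel exactly.
    have h3 : m * P ^ 2 = l * Q ^ 2 := by rw [h1, h2]; field_simp
    rw [hY, hX, zero_add, zero_add]
    field_simp
    linarith
  · refine ⟨_, ((tendsto_const_nhds (x := (0 : ℝ))).sub ((aux X P Q hX).const_mul (l : ℝ))).congr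
      fun s => ?_⟩
    simp [h.cross_x hY hX]
  · refine ⟨_, (((aux Y Q P hY).const_mul (m : ℝ)).sub (tendsto_const_nhds (x := (0 : ℝ)))).congr
      fun s => ?_⟩
    simp [h.cross_y hX hY]
  · exact ⟨_, ((aux Y Q P hY).const_mul (m : ℝ)).sub ((aux X P Q hX).const_mul (l : ℝ))⟩

end Admissible

/-- From every admissible position and direction a generating curve departs. -/
theorem exists_departure {l m : ℕ} (hl : 1 ≤ l) (hm : 1 ≤ m) {F : ℝ → ℝ} (hF : Continuous F)
    {b X Y P Q : ℝ} (hA : Admissible l m X Y P Q) :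
    ∃ δ > 0, ∃ x y p q : ℝ → ℝ,
      (∀ s ∈ Ioo b (b + δ), IsCurveAt l m F x y p q s ∧ x s ≠ 0 ∧ y s ≠ 0) ∧
      Tendsto x (𝓝[>] b) (𝓝 X) ∧ Tendsto y (𝓝[>] b) (𝓝 Y) ∧
      Tendsto p (𝓝[>] b) (𝓝 P) ∧ Tendsto q (𝓝[>] b) (𝓝 Q) := by
  obtain ⟨θ₀, hP, hQ⟩ := exists_angle hA.unit
  set k : ℕ := (if Y = 0 then m else 0) + (if X = 0 then l else 0) with hk
  -- Since cos(θ₀ + z) = sin(θ₁ - z), `x` is the sine primitive for θ₁ and -ζ, and one lemma treats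
  -- both singular terms.
  set θ₁ := Real.pi / 2 - θ₀ with hθ₁
  have hsin1 : ∀ z, Real.sin (θ₁ + -z) = Real.cos (θ₀ + z) := fun z => by
    rw [hθ₁, show Real.pi / 2 - θ₀ + -z = Real.pi / 2 - (θ₀ + z) by ring, Real.sin_pi_div_two_sub]
  have hcos1 : ∀ z, Real.cos (θ₁ + -z) = Real.sin (θ₀ + z) := fun z => by
    rw [hθ₁, show Real.pi / 2 - θ₀ + -z = Real.pi / 2 - (θ₀ + z) by ring, Real.cos_pi_div_two_sub]
  have hs1 : Real.sin θ₁ = P := by rw [hθ₁, Real.sin_pi_div_two_sub, hP]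
  have hc1 : Real.cos θ₁ = Q := by rw [hθ₁, Real.cos_pi_div_two_sub, hQ]
  let κ : (ℝ → ℝ) → ℝ → ℝ := fun ζ s =>
    m * (Real.cos (θ₀ + s * ζ s) / sinPrimitive θ₀ Y ζ s)
      - l * (Real.sin (θ₀ + s * ζ s) / sinPrimitive θ₁ X (fun τ => -ζ τ) s) - F (b + s)
  -- Adding k ζ to the curvature cancels its linear singular response and puts θ' = κ into the form
  -- (s ζ)' + k ζ = g[ζ].
  let g : (ℝ → ℝ) → ℝ → ℝ := fun ζ s => k * ζ s + κ ζ s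
  obtain ⟨c₀, hc₀⟩ := hA.exists_tendsto_line hl hm
  have hFb : Tendsto (fun s => F (b + s)) (𝓝[>] 0) (𝓝 (F b)) := by
    have : ContinuousAt (fun s => F (b + s)) 0 := by fun_prop
    have h2 := this.tendsto
    rw [add_zero] at h2
    exact h2.mono_left nhdsWithin_le_nhds
  set M := |c₀ - F b| + 1 with hM
  have hMpos : 0 < M := by positivity
  have ev0 := ((hc₀.sub hFb).abs).eventually_lt_const (lt_add_one |c₀ - F b|)
  -- An error of 1/4 for each singular term gives the total k + 1/2; F does not depend on ζ.
  have ev1 := exists_lipschitz_singular_term (θ₀ := θ₀) (Y := Y) (R := 2 * M) (ε := 1 / 4) m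
    (fun h => by rw [hQ]; exact hA.ne_zero_of_y hm h) (by norm_num) (by positivity)
  have ev2 := exists_lipschitz_singular_term (θ₀ := θ₁) (Y := X) (R := 2 * M) (ε := 1 / 4) l
    (fun h => by rw [hs1]; exact hA.ne_zero_of_x hl h) (by norm_num) (by positivity)
  rw [hP, hQ] at ev1
  rw [hs1, hc1] at ev2
  obtain ⟨δ, hδ, hsub⟩ := mem_nhdsGT_iff_exists_Ioc_subset.1 ((ev0.and ev1).and ev2)
  have hδ : 0 < δ := hδ
  have hdx : ∀ ζ, ContinuousOn ζ (Ioi 0) → (∀ s, |ζ s| ≤ 2 * M) → ∀ s, 0 < s →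
      HasDerivAt (sinPrimitive θ₁ X fun τ => -ζ τ) (Real.cos (θ₀ + s * ζ s)) s := by
    intro ζ hc hb s hs
    have := hasDerivAt_sinPrimitive (θ₀ := θ₁) (Y := X) hc.neg (fun s => by simpa using hb s) hs
    rw [Pi.neg_apply, mul_neg, hsin1] at this
    exact this
  have hdy : ∀ ζ, ContinuousOn ζ (Ioi 0) → (∀ s, |ζ s| ≤ 2 * M) → ∀ s, 0 < s →
      HasDerivAt (sinPrimitive θ₀ Y ζ) (Real.sin (θ₀ + s * ζ s)) s :=
    fun ζ hc hb s hs => hasDerivAt_sinPrimitive hc hb hs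
  have hyne : ∀ ζ, ContinuousOn ζ (Ioi 0) → (∀ s, |ζ s| ≤ 2 * M) → ∀ s ∈ Ioc 0 δ,
      sinPrimitive θ₀ Y ζ s ≠ 0 := fun ζ hc hb s hs => ((hsub hs).1.2 ζ hc hb).1
  have hxne : ∀ ζ, ContinuousOn ζ (Ioi 0) → (∀ s, |ζ s| ≤ 2 * M) → ∀ s ∈ Ioc 0 δ,
      sinPrimitive θ₁ X (fun τ => -ζ τ) s ≠ 0 := fun ζ hc hb s hs =>
    ((hsub hs).2 _ hc.neg (fun s => by simpa using hb s)).1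
  have hgc : ∀ ζ, ContinuousOn ζ (Ioi 0) → (∀ s, |ζ s| ≤ 2 * M) →
      ContinuousOn (g ζ) (Ioc 0 δ) := by
    intro ζ hc hb
    have hζ : ContinuousOn ζ (Ioc 0 δ) := hc.mono Ioc_subset_Ioi_self
    have hθ : ContinuousOn (fun s => θ₀ + s * ζ s) (Ioc 0 δ) :=
      continuousOn_const.add (continuousOn_id.mul hζ)
    refine (continuousOn_const.mul hζ).add (((continuousOn_const.mul
      ((Real.continuous_cos.comp_continuousOn hθ).div ?_ (hyne ζ hc hb))).sub
      (continuousOn_const.mul ((Real.continuous_sin.comp_continuousOn hθ).div ?_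
        (hxne ζ hc hb)))).sub ?_)
    · exact fun s hs => (hdy ζ hc hb s hs.1).continuousAt.continuousWithinAt
    · exact fun s hs => (hdx ζ hc hb s hs.1).continuousAt.continuousWithinAt
    · exact (by fun_prop : Continuous fun s => F (b + s)).continuousOn
  obtain ⟨ζ, hζc, hζb, hζ⟩ := exists_singular_fixedPoint k hδ hMpos g hgc (by
      intro ζ₁ ζ₂ D hc₁ hb₁ hc₂ hb₂ hD s hs
      have t1 := ((hsub hs).1.2 ζ₁ hc₁ hb₁).2 ζ₂ hc₂ hb₂ D hD
      have t2 := ((hsub hs).2 (fun τ => -ζ₁ τ) hc₁.neg (fun s => by simpa using hb₁ s)).2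
        (fun τ => -ζ₂ τ) hc₂.neg (fun s => by simpa using hb₂ s) D (fun s => by
          rw [neg_sub_neg, abs_sub_comm]; exact hD s)
      simp only [mul_neg, hcos1] at t2
      have hD0 : 0 ≤ D := (abs_nonneg _).trans (hD 0)
      have hcon := mul_le_mul_of_nonneg_right (hA.lipschitz_const_le hl hm) hD0
      rw [← hk] at hcon
      set A₁ := Real.cos (θ₀ + s * ζ₁ s) / sinPrimitive θ₀ Y ζ₁ s
      set A₂ := Real.cos (θ₀ + s * ζ₂ s) / sinPrimitive θ₀ Y ζ₂ s
      set B₁ := Real.sin (θ₀ + s * ζ₁ s) / sinPrimitive θ₁ X (fun τ => -ζ₁ τ) s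
      set B₂ := Real.sin (θ₀ + s * ζ₂ s) / sinPrimitive θ₁ X (fun τ => -ζ₂ τ) s
      have hkc : (k : ℝ) = ((if Y = 0 then m else 0 : ℕ) : ℝ) + ((if X = 0 then l else 0 : ℕ) : ℝ) := by
        rw [hk]; push_cast; rfl
      set ky : ℝ := ((if Y = 0 then m else 0 : ℕ) : ℝ)
      set kx : ℝ := ((if X = 0 then l else 0 : ℕ) : ℝ)
      have e : g ζ₁ s - g ζ₂ s = (m * A₁ + ky * ζ₁ s - (m * A₂ + ky * ζ₂ s))
          - (l * B₁ + -(kx * ζ₁ s) - (l * B₂ + -(kx * ζ₂ s))) := by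
        simp only [g, κ, hkc]; ring
      rw [e]
      refine (abs_sub _ _).trans ((add_le_add t1 t2).trans ?_)
      nlinarith) (by
      intro s hs
      have h1 := (hsub hs).1.1
      have e : g (fun _ => 0) s = m * (P / (Y + s * Q)) - l * (Q / (X + s * P)) - F (b + s) := by
        simp only [g, κ, mul_zero, add_zero, zero_add, neg_zero, sinPrimitive_zero, hP, hQ, hs1]
      rw [e]
      exact h1.le)
  have hζd : ∀ s ∈ Ioo 0 δ, HasDerivAt (fun s => θ₀ + s * ζ s) (κ ζ s) s := fun s hs =>
    ((hζ s hs).const_add θ₀).congr_deriv (by simp only [g]; ring)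
  have hθ : Tendsto (fun s => θ₀ + (s - b) * ζ (s - b)) (𝓝[>] b) (𝓝 θ₀) := by
    have h1 : Tendsto (fun s => (s - b) * ζ (s - b)) (𝓝 b) (𝓝 0) := by
      refine squeeze_zero_norm (a := fun s => |s - b| * (2 * M)) (fun s => ?_) ?_
      · rw [Real.norm_eq_abs, abs_mul]; gcongr; exact hζb _
      · have h1 : Continuous fun s : ℝ => |s - b| * (2 * M) := by fun_prop
        simpa using h1.tendsto b
    simpa using (h1.const_add θ₀).mono_left nhdsWithin_le_nhds
  have hshift : Tendsto (fun s => s - b) (𝓝[>] b) (𝓝[>] 0) := by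
    refine tendsto_nhdsWithin_of_tendsto_nhds_of_eventually_within _ ?_ ?_
    · have : Continuous fun s : ℝ => s - b := by fun_prop
      simpa using (this.tendsto b).mono_left nhdsWithin_le_nhds
    · filter_upwards [self_mem_nhdsWithin] with s hs using sub_pos.2 (mem_Ioi.1 hs)
  refine ⟨δ, hδ, fun s => sinPrimitive θ₁ X (fun τ => -ζ τ) (s - b),
    fun s => sinPrimitive θ₀ Y ζ (s - b), fun s => Real.cos (θ₀ + (s - b) * ζ (s - b)),
    fun s => Real.sin (θ₀ + (s - b) * ζ (s - b)), fun s hs => ?_,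
    tendsto_sinPrimitive.comp hshift, tendsto_sinPrimitive.comp hshift, ?_, ?_⟩
  · have hs' : s - b ∈ Ioo 0 δ := ⟨by linarith [hs.1], by linarith [hs.2]⟩
    have hx0 := hxne ζ hζc hζb _ (Ioo_subset_Ioc_self hs')
    have hy0 := hyne ζ hζc hζb _ (Ioo_subset_Ioc_self hs')
    have dx := (hdx ζ hζc hζb _ hs'.1).comp_sub_const s b
    have dy := (hdy ζ hζc hζb _ hs'.1).comp_sub_const s b
    have dθ := (hζd _ hs').comp_sub_const s b
    have hκ : κ ζ (s - b) = prescribedCurvature l m F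
        (fun s => sinPrimitive θ₁ X (fun τ => -ζ τ) (s - b)) (fun s => sinPrimitive θ₀ Y ζ (s - b))
        (fun s => Real.cos (θ₀ + (s - b) * ζ (s - b)))
        (fun s => Real.sin (θ₀ + (s - b) * ζ (s - b))) s := by
      simp only [κ, prescribedCurvature, add_sub_cancel]
    refine ⟨⟨dx, dy, dθ.cos.continuousAt, dθ.sin.continuousAt, fun _ _ => ?_, fun _ _ => ?_, ?_,
      ⟨Real.cos_sq_add_sin_sq _, fun h => absurd h hy0, fun h => absurd h hx0,
        fun h => absurd h hx0⟩⟩, hx0, hy0⟩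
    · rw [← hκ]; exact dθ.cos
    · rw [← hκ]; exact dθ.sin
    · exact ((dx.continuousAt.eventually_ne hx0).and (dy.continuousAt.eventually_ne hy0)).filter_mono
        nhdsWithin_le_nhds
  · rw [← hP]; exact (Real.continuous_cos.tendsto θ₀).comp hθ
  · rw [← hQ]; exact (Real.continuous_sin.tendsto θ₀).comp hθ

/-! ### Arrival in general, joining, and extension to the line -/

/-- At the end of a finite interval a generating curve has a limit with admissible data, and it
meets no axis shortly before. -/
theorem exists_arrival {l m : ℕ} (hl : 1 ≤ l) (hm : 1 ≤ m) {F x y p q : ℝ → ℝ} {a b : ℝ}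
    (hF : Continuous F) (hab : a < b) (h : ∀ s ∈ Ioo a b, IsCurveAt l m F x y p q s) :
    ∃ X Y P Q, Admissible l m X Y P Q ∧ (∀ᶠ s in 𝓝[<] b, x s ≠ 0 ∧ y s ≠ 0) ∧
      Tendsto x (𝓝[<] b) (𝓝 X) ∧ Tendsto y (𝓝[<] b) (𝓝 Y) ∧
      Tendsto p (𝓝[<] b) (𝓝 P) ∧ Tendsto q (𝓝[<] b) (𝓝 Q) := by
  obtain ⟨X, hX⟩ := exists_tendsto_left_of_deriv_bounded (fun s hs => (h s hs).deriv_x)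
    (fun s hs => (h s hs).admissible.abs_le.1) hab
  obtain ⟨Y, hY⟩ := exists_tendsto_left_of_deriv_bounded (fun s hs => (h s hs).deriv_y)
    (fun s hs => (h s hs).admissible.abs_le.2) hab
  have hmem : ∀ᶠ s in 𝓝[<] b, s ∈ Ioo a b := Ioo_mem_nhdsLT hab
  by_cases hX0 : X = 0 <;> by_cases hY0 : Y = 0
  · subst hX0 hY0
    obtain ⟨hne, P, Q, hP, hQ, hPl, hQl⟩ := arrival_origin hl hm hF hab h hX hY
    refine ⟨0, 0, P, Q, ⟨?_, fun _ h => absurd rfl h, fun _ h => absurd rfl h,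
      fun _ _ => ⟨hP, hQ⟩⟩, hne, hX, hY, hPl, hQl⟩
    have : (0 : ℝ) < l := by exact_mod_cast hl
    rw [hP, hQ]; field_simp
  · subst hX0
    -- Interchanging the coordinates reverses the sign of the curvature, whence -F.
    obtain ⟨hne, hq, P, hP, hPl⟩ := arrival_x_axis hl hF.neg hab (fun s hs => (h s hs).swap) hY hY0 hX
    exact ⟨0, Y, P, 0, ⟨by simpa using hP, fun h => absurd h hY0, fun _ _ => rfl,
      fun _ h => absurd h hY0⟩, hne.mono fun s hs => hs.symm, hX, hY, hPl, hq⟩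
  · subst hY0
    obtain ⟨hne, hp, Q, hQ, hQl⟩ := arrival_x_axis hm hF hab h hX hX0 hY
    exact ⟨X, 0, 0, Q, ⟨by simpa using hQ, fun _ _ => rfl, fun h => absurd h hX0,
      fun h => absurd h hX0⟩, hne, hX, hY, hp, hQl⟩
  · have hne : ∀ᶠ s in 𝓝[<] b, x s ≠ 0 ∧ y s ≠ 0 :=
      (hX.eventually_ne hX0).and (hY.eventually_ne hY0)
    set M : ℝ := m * (2 / |Y|) + l * (2 / |X|) + (|F b| + 1) with hM
    have hXpos : 0 < |X| := abs_pos.2 hX0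
    have hYpos : 0 < |Y| := abs_pos.2 hY0
    have hk : ∀ᶠ s in 𝓝[<] b, |prescribedCurvature l m F x y p q s| ≤ M := by
      filter_upwards [hmem, hX.abs.eventually_const_lt (half_lt_self hXpos),
        hY.abs.eventually_const_lt (half_lt_self hYpos),
        (hF.abs.continuousAt.eventually_lt_const (lt_add_one |F b|)).filter_mono
          nhdsWithin_le_nhds] with s hs h1 h2 h3
      have hA := (h s hs).admissible.abs_le
      have aux : ∀ u v V : ℝ, |u| ≤ 1 → 0 < |V| → |V| / 2 < |v| → |u / v| ≤ 2 / |V| := by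
        intro u v V hu hV hv
        rw [abs_div]
        calc |u| / |v| ≤ 1 / (|V| / 2) := by gcongr
          _ = 2 / |V| := by field_simp
      have e1 := aux _ _ _ hA.1 hYpos h2
      have e2 := aux _ _ _ hA.2 hXpos h1
      rw [prescribedCurvature]
      refine (abs_sub _ _).trans (add_le_add ((abs_sub _ _).trans (add_le_add ?_ ?_)) h3.le)
      · rw [abs_mul, Nat.abs_cast]; gcongr
      · rw [abs_mul, Nat.abs_cast]; gcongr
    obtain ⟨a', ha', hsub⟩ := (mem_nhdsLT_iff_exists_Ioo_subset).1 (hmem.and (hne.and hk))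
    obtain ⟨P, hP⟩ := exists_tendsto_left_of_deriv_bounded (C := M) (fun s (hs : s ∈ Ioo a' b) =>
      (h s (hsub hs).1).deriv_p (hsub hs).2.1.1 (hsub hs).2.1.2) (fun s hs => by
        rw [abs_mul, abs_neg]
        exact (mul_le_of_le_one_left (abs_nonneg _)
          (h s (hsub hs).1).admissible.abs_le.2).trans (hsub hs).2.2) ha'
    obtain ⟨Q, hQ⟩ := exists_tendsto_left_of_deriv_bounded (C := M) (fun s (hs : s ∈ Ioo a' b) =>
      (h s (hsub hs).1).deriv_q (hsub hs).2.1.1 (hsub hs).2.1.2) (fun s hs => by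
        rw [abs_mul]
        exact (mul_le_of_le_one_left (abs_nonneg _)
          (h s (hsub hs).1).admissible.abs_le.1).trans (hsub hs).2.2) ha'
    refine ⟨X, Y, P, Q, ⟨?_, fun h => absurd h hY0, fun h => absurd h hX0, fun h => absurd h hX0⟩,
      hne, hX, hY, hP, hQ⟩
    refine tendsto_nhds_unique ((hP.pow 2).add (hQ.pow 2)) (tendsto_const_nhds.congr' ?_)
    filter_upwards [hmem] with s hs using (h s hs).admissible.unit.symm

/-- `IsCurveAt` for the quadruple `(x, y, p, q)`. -/
def IsCurveTupleAt (l m : ℕ) (F : ℝ → ℝ) (γ : ℝ → ℝ × ℝ × ℝ × ℝ) (s : ℝ) : Prop :=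
  IsCurveAt l m F (fun t => (γ t).1) (fun t => (γ t).2.1) (fun t => (γ t).2.2.1)
    (fun t => (γ t).2.2.2) s

theorem IsCurveTupleAt.congr {l m : ℕ} {F : ℝ → ℝ} {γ γ₁ : ℝ → ℝ × ℝ × ℝ × ℝ} {s : ℝ}
    (h : IsCurveTupleAt l m F γ s) (hγ : γ =ᶠ[𝓝 s] γ₁) : IsCurveTupleAt l m F γ₁ s :=
  IsCurveAt.congr h (hγ.mono fun _ ht => by simp only [ht]) (hγ.mono fun _ ht => by simp only [ht])
    (hγ.mono fun _ ht => by simp only [ht]) (hγ.mono fun _ ht => by simp only [ht])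

/-- Two generating curves with the same admissible limit at a common end point join to one. -/
theorem exists_join {l m : ℕ} {F : ℝ → ℝ} (hF : Continuous F) {γ₁ γ₂ : ℝ → ℝ × ℝ × ℝ × ℝ}
    {a b c : ℝ} {v : ℝ × ℝ × ℝ × ℝ} (hab : a < b) (hbc : b < c)
    (h₁ : ∀ s ∈ Ioo a b, IsCurveTupleAt l m F γ₁ s)
    (h₂ : ∀ s ∈ Ioo b c, IsCurveTupleAt l m F γ₂ s)
    (hne₁ : ∀ᶠ s in 𝓝[<] b, (γ₁ s).1 ≠ 0 ∧ (γ₁ s).2.1 ≠ 0)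
    (hne₂ : ∀ᶠ s in 𝓝[>] b, (γ₂ s).1 ≠ 0 ∧ (γ₂ s).2.1 ≠ 0)
    (hl₁ : Tendsto γ₁ (𝓝[<] b) (𝓝 v)) (hl₂ : Tendsto γ₂ (𝓝[>] b) (𝓝 v))
    (hv : Admissible l m v.1 v.2.1 v.2.2.1 v.2.2.2) :
    ∃ γ : ℝ → ℝ × ℝ × ℝ × ℝ, (∀ s ∈ Ioo a c, IsCurveTupleAt l m F γ s) ∧
      EqOn γ₁ γ (Ioo a b) ∧ γ b = v := by
  let γ : ℝ → ℝ × ℝ × ℝ × ℝ := fun s => if s < b then γ₁ s else if b < s then γ₂ s else v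
  have e₁ : ∀ s < b, γ s = γ₁ s := fun s hs => if_pos hs
  have e₂ : ∀ s, b < s → γ s = γ₂ s := fun s hs => by
    simp only [γ, if_neg hs.le.not_gt, if_pos hs]
  have eb : γ b = v := by simp [γ]
  have g₁ : ∀ s ∈ Ioo a b, IsCurveTupleAt l m F γ s := fun s hs => (h₁ s hs).congr (by
    filter_upwards [Iio_mem_nhds hs.2] with t ht using (e₁ t ht).symm)
  have g₂ : ∀ s ∈ Ioo b c, IsCurveTupleAt l m F γ s := fun s hs => (h₂ s hs).congr (by
    filter_upwards [Ioi_mem_nhds hs.1] with t ht using (e₂ t ht).symm)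
  have hsplit : 𝓝[≠] b = 𝓝[<] b ⊔ 𝓝[>] b := by rw [← Iio_union_Ioi, nhdsWithin_union]
  have hcont : ContinuousAt γ b := by
    rw [continuousAt_iff_continuous_left'_right']
    refine ⟨?_, ?_⟩ <;> rw [ContinuousWithinAt, eb]
    · refine hl₁.congr' ?_
      filter_upwards [self_mem_nhdsWithin] with s hs using (e₁ s hs).symm
    · refine hl₂.congr' ?_
      filter_upwards [self_mem_nhdsWithin] with s hs using (e₂ s hs).symm
  refine ⟨γ, fun s hs => ?_, fun s hs => (e₁ s hs.2).symm, eb⟩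
  rcases lt_trichotomy s b with h | rfl | h
  · exact g₁ s ⟨hs.1, h⟩
  · refine isCurveAt_of_punctured hF ?_ hcont.fst hcont.snd.fst hcont.snd.snd.fst
      hcont.snd.snd.snd ?_ ?_
    · rw [hsplit]
      exact eventually_sup.2 ⟨mem_of_superset (Ioo_mem_nhdsLT hab) g₁,
        mem_of_superset (Ioo_mem_nhdsGT hbc) g₂⟩
    · rw [hsplit]
      refine eventually_sup.2 ⟨?_, ?_⟩
      · filter_upwards [hne₁, self_mem_nhdsWithin] with t ht ht'
        rwa [e₁ t ht']
      · filter_upwards [hne₂, self_mem_nhdsWithin] with t ht ht'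
        rwa [e₂ t ht']
    · simp only [eb]; exact hv
  · exact g₂ s ⟨h, hs.2⟩

/-- The limit data at the endpoint are admissible, so a new curve departs from exactly these data
and is joined on. -/
theorem exists_extension {l m : ℕ} (hl : 1 ≤ l) (hm : 1 ≤ m) {F : ℝ → ℝ} (hF : Continuous F)
    {γ : ℝ → ℝ × ℝ × ℝ × ℝ} {a b : ℝ} (hab : a < b)
    (h : ∀ s ∈ Ioo a b, IsCurveTupleAt l m F γ s) :
    ∃ b' > b, ∃ γ', (∀ s ∈ Ioo a b', IsCurveTupleAt l m F γ' s) ∧ EqOn γ γ' (Ioo a b) := by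
  obtain ⟨X, Y, P, Q, hA, hne, hx, hy, hp, hq⟩ := exists_arrival hl hm hF hab h
  obtain ⟨δ, hδ, x, y, p, q, hc, hx', hy', hp', hq'⟩ := exists_departure hl hm hF (b := b) hA
  obtain ⟨γ', h1, h2, -⟩ := exists_join (γ₁ := γ) (γ₂ := fun s => (x s, y s, p s, q s))
    (v := (X, Y, P, Q)) hF hab (by linarith : b < b + δ) h (fun s hs => (hc s hs).1) hne
    (mem_of_superset (Ioo_mem_nhdsGT (by linarith : b < b + δ)) fun s hs => (hc s hs).2)
    (hx.prodMk_nhds (hy.prodMk_nhds (hp.prodMk_nhds hq)))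
    (hx'.prodMk_nhds (hy'.prodMk_nhds (hp'.prodMk_nhds hq'))) hA
  exact ⟨b + δ, by linarith, γ', h1, h2⟩

theorem exists_extension_Ioi {l m : ℕ} (hl : 1 ≤ l) (hm : 1 ≤ m) {F : ℝ → ℝ} (hF : Continuous F)
    {γ : ℝ → ℝ × ℝ × ℝ × ℝ} {a b : ℝ} (hab : a < b)
    (h : ∀ s ∈ Ioo a b, IsCurveTupleAt l m F γ s) :
    ∃ γ', (∀ s ∈ Ioi a, IsCurveTupleAt l m F γ' s) ∧ EqOn γ γ' (Ioo a b) :=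
  exists_continuation_Ioi (IsCurveTupleAt l m F) (fun _ _ _ h1 h2 => h2.congr h1)
    (fun _ _ hab h => exists_extension hl hm hF hab h) hab h

/-- The reversal of a quadruple `(x, y, p, q)`. -/
def reverseTuple (γ : ℝ → ℝ × ℝ × ℝ × ℝ) (s : ℝ) : ℝ × ℝ × ℝ × ℝ :=
  ((γ (-s)).1, (γ (-s)).2.1, -(γ (-s)).2.2.1, -(γ (-s)).2.2.2)

theorem IsCurveTupleAt.reverse {l m : ℕ} {F : ℝ → ℝ} {γ : ℝ → ℝ × ℝ × ℝ × ℝ} {s : ℝ}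
    (h : IsCurveTupleAt l m F γ (-s)) :
    IsCurveTupleAt l m (fun t => -F (-t)) (reverseTuple γ) s :=
  IsCurveAt.reverse h

/-- The left half is a departure of the reversed system with opposite tangent, run backwards. -/
theorem exists_local {l m : ℕ} (hl : 1 ≤ l) (hm : 1 ≤ m) {F : ℝ → ℝ} (hF : Continuous F)
    {s₀ X Y P Q : ℝ} (hA : Admissible l m X Y P Q) :
    ∃ a < s₀, ∃ b > s₀, ∃ γ, (∀ s ∈ Ioo a b, IsCurveTupleAt l m F γ s) ∧ γ s₀ = (X, Y, P, Q) := by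
  obtain ⟨δ, hδ, x, y, p, q, hc, hx, hy, hp, hq⟩ := exists_departure hl hm hF (b := s₀) hA
  obtain ⟨ε, hε, x', y', p', q', hc', hx', hy', hp', hq'⟩ :=
    exists_departure hl hm (F := fun t => -F (-t)) (by fun_prop) (b := -s₀) hA.neg
  have ht : Tendsto (fun t : ℝ => -t) (𝓝[<] s₀) (𝓝[>] (-s₀)) := tendsto_neg_nhdsLT
  have hmem : ∀ s ∈ Ioo (s₀ - ε) s₀, -s ∈ Ioo (-s₀) (-s₀ + ε) := fun s hs =>
    ⟨by linarith [hs.2], by linarith [hs.1]⟩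
  have hp'' := (hp'.comp ht).neg
  have hq'' := (hq'.comp ht).neg
  rw [neg_neg] at hp'' hq''
  obtain ⟨γ, h1, -, h3⟩ := exists_join (γ₁ := reverseTuple fun s => (x' s, y' s, p' s, q' s))
    (γ₂ := fun s => (x s, y s, p s, q s))
    (v := (X, Y, P, Q)) hF (by linarith : s₀ - ε < s₀) (by linarith : s₀ < s₀ + δ) (fun s hs => by
      have := (hc' _ (hmem s hs)).1.reverse
      simp only [neg_neg] at this
      exact this) (fun s hs => (hc s hs).1)
    (mem_of_superset (Ioo_mem_nhdsLT (by linarith : s₀ - ε < s₀)) fun s hs =>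
      (hc' _ (hmem s hs)).2)
    (mem_of_superset (Ioo_mem_nhdsGT (by linarith : s₀ < s₀ + δ)) fun s hs => (hc s hs).2)
    ((hx'.comp ht).prodMk_nhds ((hy'.comp ht).prodMk_nhds (hp''.prodMk_nhds hq'')))
    (hx.prodMk_nhds (hy.prodMk_nhds (hp.prodMk_nhds hq))) hA
  exact ⟨s₀ - ε, by linarith, s₀ + δ, by linarith, γ, h1, h3⟩

theorem exists_global {l m : ℕ} (hl : 1 ≤ l) (hm : 1 ≤ m) {F : ℝ → ℝ} (hF : Continuous F)
    {s₀ X Y P Q : ℝ} (hA : Admissible l m X Y P Q) :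
    ∃ γ, (∀ s, IsCurveTupleAt l m F γ s) ∧ γ s₀ = (X, Y, P, Q) := by
  obtain ⟨a, ha, b, hb, γ, hγ, hγ0⟩ := exists_local hl hm hF (s₀ := s₀) hA
  obtain ⟨γ₁, h1, e1⟩ := exists_extension_Ioi hl hm hF (ha.trans hb) hγ
  obtain ⟨γ₂, h2, e2⟩ := exists_extension_Ioi hl hm (F := fun t => -F (-t)) (by fun_prop)
    (γ := reverseTuple γ) (a := -b) (b := -a) (by linarith) (fun s hs =>
      (hγ (-s) ⟨by linarith [hs.2], by linarith [hs.1]⟩).reverse)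
  have h3 : ∀ s < b, IsCurveTupleAt l m F (reverseTuple γ₂) s := fun s hs => by
    have := (h2 (-s) (by simpa using hs)).reverse
    simpa using this
  have e3 : EqOn γ (reverseTuple γ₂) (Ioo a b) := fun s hs => by
    have hs' : -s ∈ Ioo (-b) (-a) := ⟨by linarith [hs.2], by linarith [hs.1]⟩
    simp [reverseTuple, ← e2 hs']
  let Γ : ℝ → ℝ × ℝ × ℝ × ℝ := fun s => if s < s₀ then reverseTuple γ₂ s else γ₁ s
  -- The two half-line extensions agree on the initial interval, so switching at `s₀` leaves no
  -- seam.
  have E1 : ∀ s, a < s → Γ s = γ₁ s := fun s hs => by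
    by_cases h : s < s₀
    · simp only [Γ, if_pos h]
      rw [← e3 ⟨hs, h.trans hb⟩, e1 ⟨hs, h.trans hb⟩]
    · simp only [Γ, if_neg h]
  refine ⟨Γ, fun s => ?_, ?_⟩
  · rcases lt_or_ge s s₀ with h | h
    · refine (h3 s (h.trans hb)).congr ?_
      filter_upwards [Iio_mem_nhds h] with t ht using (if_pos ht).symm
    · refine (h1 s (ha.trans_le h)).congr ?_
      filter_upwards [Ioi_mem_nhds (ha.trans_le h)] with t ht using (E1 t ht).symm
  · rw [E1 s₀ ha, ← e1 ⟨ha, hb⟩, hγ0]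

/-! ### Regularity and the classical equation -/

/-- A function with derivative `f'` near `b` is `C¹` at `b` if `f'` is continuous near `b`. -/
theorem contDiffAt_one_of_hasDerivAt {f f' : ℝ → ℝ} {b : ℝ}
    (h : ∀ᶠ s in 𝓝 b, HasDerivAt f (f' s) s) (hc : ∀ᶠ s in 𝓝 b, ContinuousAt f' s) :
    ContDiffAt ℝ 1 f b := by
  obtain ⟨U, hU, hUo, hbU⟩ := eventually_nhds_iff.1 (h.and hc)
  refine ContDiffOn.contDiffAt ?_ (hUo.mem_nhds hbU)
  rw [show (1 : WithTop ℕ∞) = 0 + 1 by norm_num, contDiffOn_succ_iff_deriv_of_isOpen hUo]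
  refine ⟨fun s hs => (hU s hs).1.differentiableAt.differentiableWithinAt, by simp, ?_⟩
  rw [contDiffOn_zero]
  exact ContinuousOn.congr (fun s hs => (hU s hs).2.continuousWithinAt)
    fun s hs => (hU s hs).1.deriv

theorem contDiffAt_two_of_hasDerivAt {f f' : ℝ → ℝ} {b : ℝ}
    (h : ∀ᶠ s in 𝓝 b, HasDerivAt f (f' s) s) (hc : ContDiffAt ℝ 1 f' b) :
    ContDiffAt ℝ 2 f b := by
  obtain ⟨U, hU, hUo, hbU⟩ := eventually_nhds_iff.1
    (h.and (hc.eventually (by simp)))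
  refine ContDiffOn.contDiffAt ?_ (hUo.mem_nhds hbU)
  rw [show (2 : WithTop ℕ∞) = 1 + 1 by norm_num, contDiffOn_succ_iff_deriv_of_isOpen hUo]
  refine ⟨fun s hs => (hU s hs).1.differentiableAt.differentiableWithinAt, by simp, ?_⟩
  exact ContDiffOn.congr (fun s hs => (hU s hs).2.contDiffWithinAt) fun s hs => (hU s hs).1.deriv

section Regularity

variable {l m : ℕ} {F x y p q : ℝ → ℝ}

/-- The prescribed curvature has a limit where the curve crosses the axis `y = 0` off the origin. -/
theorem exists_tendsto_curvature_x_axis (hm : 1 ≤ m) (hF : Continuous F)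
    (h : ∀ s, IsCurveAt l m F x y p q s) {b : ℝ} (hx : x b ≠ 0) (hy : y b = 0) :
    ∃ c, Tendsto (prescribedCurvature l m F x y p q) (𝓝[≠] b) (𝓝 c) := by
  have hb := h b
  have hq0 : q b ≠ 0 := hb.admissible.ne_zero_of_y hm hy
  have hmR : (0 : ℝ) < m + 1 := by positivity
  have hcx := hb.deriv_x.continuousAt
  have hcy := hb.deriv_y.continuousAt
  have hxne : ∀ᶠ s in 𝓝[≠] b, x s ≠ 0 := hb.isolated.mono fun s hs => hs.1
  have hyne : ∀ᶠ s in 𝓝[≠] b, y s ≠ 0 := hb.isolated.mono fun s hs => hs.2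
  have hqne : ∀ᶠ s in 𝓝[≠] b, q s ≠ 0 :=
    (hb.cont_q.eventually_ne hq0).filter_mono nhdsWithin_le_nhds
  have hg : ContinuousAt (fun s => l * (q s / x s) + F s) b :=
    ((hb.cont_q.div hcx hx).const_mul _).add hF.continuousAt
  -- L'Hôpital for |y|^m p over |y|^m y yields p/y → (l q/x + F)/(m + 1), the value of the curvature
  -- quotient on the axis.
  have key := HasDerivAt.lhopital_zero_nhdsNE (a := b)
    (l := 𝓝 ((l * (q b / x b) + F b) / (m + 1)))
    (f := fun t => |y t| ^ m * p t) (f' := fun s => |y s| ^ m * (q s * (l * (q s / x s) + F s)))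
    (g := fun t => |y t| ^ m * y t)
    (g' := fun s => |y s| ^ m * (m * (q s / y s)) * y s + |y s| ^ m * q s)
    (hxne.mono fun s hs => (h s).hasDerivAt_abs_y_pow_mul hm hs)
    (hyne.mono fun s hs => ((h s).deriv_y.abs_pow_of_ne m hs).mul (h s).deriv_y)
    (by
      filter_upwards [hyne, hqne] with s h1 h2
      have e : |y s| ^ m * (m * (q s / y s)) * y s + |y s| ^ m * q s
          = |y s| ^ m * ((m + 1) * q s) := by field_simp
      rw [e]
      have := hmR.ne'
      positivity)
    (by
      have : ContinuousAt (fun t => |y t| ^ m * p t) b := (hcy.abs.pow m).mul hb.cont_p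
      have h2 := this.tendsto
      rw [hb.admissible.cross_x hy hx, mul_zero] at h2
      exact h2.mono_left nhdsWithin_le_nhds)
    (by
      have : ContinuousAt (fun t => |y t| ^ m * y t) b := (hcy.abs.pow m).mul hcy
      have h2 := this.tendsto
      rw [hy, mul_zero] at h2
      exact h2.mono_left nhdsWithin_le_nhds)
    (by
      refine ((hg.tendsto.div_const ((m : ℝ) + 1)).mono_left nhdsWithin_le_nhds).congr' ?_
      filter_upwards [hyne, hqne] with s h1 h2
      have : |y s| ^ m ≠ 0 := by positivity
      generalize l * (q s / x s) + F s = g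
      field_simp)
  have hpy : Tendsto (fun s => p s / y s) (𝓝[≠] b) (𝓝 ((l * (q b / x b) + F b) / (m + 1))) := by
    refine key.congr' ?_
    filter_upwards [hyne] with s h1
    have : |y s| ^ m ≠ 0 := by positivity
    field_simp
  refine ⟨_, ((hpy.const_mul (m : ℝ)).sub (hg.tendsto.mono_left nhdsWithin_le_nhds)).congr
    fun s => ?_⟩
  simp only [prescribedCurvature]; ring

theorem exists_tendsto_curvature (hl : 1 ≤ l) (hm : 1 ≤ m) (hF : Continuous F)
    (h : ∀ s, IsCurveAt l m F x y p q s) {b : ℝ} (hb : ¬ (x b = 0 ∧ y b = 0)) :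
    ∃ c, Tendsto (prescribedCurvature l m F x y p q) (𝓝[≠] b) (𝓝 c) := by
  by_cases hy : y b = 0
  · exact exists_tendsto_curvature_x_axis hm hF h (fun hx => hb ⟨hx, hy⟩) hy
  by_cases hx : x b = 0
  · obtain ⟨c, hc⟩ := exists_tendsto_curvature_x_axis hl hF.neg (fun s => (h s).swap) hy hx
    refine ⟨-c, hc.neg.congr fun s => ?_⟩
    simp only [prescribedCurvature, Pi.neg_apply]; ring
  · exact ⟨_, (continuousAt_prescribedCurvature hF (h b).deriv_x.continuousAt
      (h b).deriv_y.continuousAt (h b).cont_p (h b).cont_q hx hy).mono_left nhdsWithin_le_nhds⟩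

/-- A generating curve is `C²` away from the origin. -/
theorem contDiffAt_two_of_isCurveAt (hl : 1 ≤ l) (hm : 1 ≤ m) (hF : Continuous F)
    (h : ∀ s, IsCurveAt l m F x y p q s) {b : ℝ} (hb : ¬ (x b = 0 ∧ y b = 0)) :
    ContDiffAt ℝ 2 x b ∧ ContDiffAt ℝ 2 y b := by
  obtain ⟨c, hc⟩ := exists_tendsto_curvature hl hm hF h hb
  set κ := prescribedCurvature l m F x y p q with hκ
  -- On an axis `κ b` involves a division by zero, so its value is replaced by the limit; p' = -q K
  -- and q' = p K then hold through `b` with continuous right sides.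
  set K := Function.update κ b c with hK
  have hKb : ContinuousAt K b := continuousAt_update_same.2 hc
  have hKne : ∀ s, s ≠ b → K =ᶠ[𝓝 s] κ := fun s hs => by
    filter_upwards [isOpen_ne.mem_nhds hs] with t ht using Function.update_of_ne ht _ _
  have hiso := eventually_nhdsWithin_iff.1 (h b).isolated
  have hKc : ∀ᶠ s in 𝓝 b, ContinuousAt K s := by
    filter_upwards [hiso] with s hs
    rcases eq_or_ne s b with rfl | hne
    · exact hKb
    · obtain ⟨h1, h2⟩ := hs hne
      exact (continuousAt_prescribedCurvature hF (h s).deriv_x.continuousAt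
        (h s).deriv_y.continuousAt (h s).cont_p (h s).cont_q h1 h2).congr (hKne s hne).symm
  have dp : ∀ᶠ s in 𝓝 b, HasDerivAt p (-q s * K s) s := by
    filter_upwards [hiso] with s hs
    rcases eq_or_ne s b with rfl | hne
    · refine hasDerivAt_of_tendsto_punctured ((h s).isolated.mono fun t ht =>
        (h t).deriv_p ht.1 ht.2) (h s).cont_p ?_
      rw [hK, Function.update_self]
      exact ((h s).cont_q.neg.tendsto.mono_left nhdsWithin_le_nhds).mul hc
    · rw [(hKne s hne).eq_of_nhds]
      exact (h s).deriv_p (hs hne).1 (hs hne).2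
  have dq : ∀ᶠ s in 𝓝 b, HasDerivAt q (p s * K s) s := by
    filter_upwards [hiso] with s hs
    rcases eq_or_ne s b with rfl | hne
    · refine hasDerivAt_of_tendsto_punctured ((h s).isolated.mono fun t ht =>
        (h t).deriv_q ht.1 ht.2) (h s).cont_q ?_
      rw [hK, Function.update_self]
      exact ((h s).cont_p.tendsto.mono_left nhdsWithin_le_nhds).mul hc
    · rw [(hKne s hne).eq_of_nhds]
      exact (h s).deriv_q (hs hne).1 (hs hne).2
  exact ⟨contDiffAt_two_of_hasDerivAt (Eventually.of_forall fun s => (h s).deriv_x)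
      (contDiffAt_one_of_hasDerivAt dp (hKc.mono fun s hs => (h s).cont_q.neg.mul hs)),
    contDiffAt_two_of_hasDerivAt (Eventually.of_forall fun s => (h s).deriv_y)
      (contDiffAt_one_of_hasDerivAt dq (hKc.mono fun s hs => (h s).cont_p.mul hs))⟩

theorem isGlobalGeneratingCurve_of_isCurveAt {n : ℕ} {H : ℝ → ℝ} (hl : 1 ≤ l) (hm : 1 ≤ m)
    (hH : Continuous H) (h : ∀ s, IsCurveAt l m (fun s => ((n : ℝ) - 1) * H s) x y p q s) :
    IsGlobalGeneratingCurve l m n H x y := by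
  have dx : deriv x = p := funext fun s => (h s).deriv_x.deriv
  have dy : deriv y = q := funext fun s => (h s).deriv_y.deriv
  have hF : Continuous fun s => ((n : ℝ) - 1) * H s := by fun_prop
  refine
    { contDiff_x := contDiff_iff_contDiffAt.2 fun s => contDiffAt_one_of_hasDerivAt
        (Eventually.of_forall fun s => (h s).deriv_x) (Eventually.of_forall fun s => (h s).cont_p)
      contDiff_y := contDiff_iff_contDiffAt.2 fun s => contDiffAt_one_of_hasDerivAt
        (Eventually.of_forall fun s => (h s).deriv_y) (Eventually.of_forall fun s => (h s).cont_q)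
      contDiffAt_two := fun s hs => contDiffAt_two_of_isCurveAt hl hm hF h hs
      unit_speed := fun s => by rw [dx, dy]; exact (h s).admissible.unit
      equation := fun s h1 h2 => ?_
      isolated := fun b => (h b).isolated
      cross_x_axis := fun b h1 h2 => by rw [dx]; exact (h b).admissible.cross_x h1 h2
      cross_y_axis := fun b h1 h2 => by rw [dy]; exact (h b).admissible.cross_y h1 h2
      cross_origin := fun b h1 h2 => by rw [dx, dy]; exact (h b).admissible.cross_origin h1 h2 }
  rw [generatingEq, dx, dy, ((h s).deriv_p h1 h2).deriv, ((h s).deriv_q h1 h2).deriv]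
  have hk : prescribedCurvature l m (fun s => ((n : ℝ) - 1) * H s) x y p q s
      = m * (p s / y s) - l * (q s / x s) - ((n : ℝ) - 1) * H s := rfl
  have hu := (h s).admissible.unit
  linear_combination hk + prescribedCurvature l m (fun s => ((n : ℝ) - 1) * H s) x y p q s * hu

end Regularity

theorem theorem4p1 (l m n : ℕ) (hl : 1 ≤ l) (hm : 1 ≤ m) (hn : (l + 1) + (m + 1) = n)
    (H : ℝ → ℝ) (hH : Continuous H) (s₀ c d c' d' : ℝ) (hc : 0 < c) (hd : 0 < d)
    (hunit : c' ^ 2 + d' ^ 2 = 1) :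
    ∃ x y : ℝ → ℝ, IsGlobalGeneratingCurve l m n H x y ∧
      x s₀ = c ∧ y s₀ = d ∧ deriv x s₀ = c' ∧ deriv y s₀ = d' := by
  obtain ⟨γ, hγ, h0⟩ := exists_global hl hm (F := fun s => ((n : ℝ) - 1) * H s) (by fun_prop)
    (s₀ := s₀) (X := c) (Y := d) (P := c') (Q := d')
    ⟨hunit, fun h => absurd h hd.ne', fun h => absurd h hc.ne', fun h => absurd h hc.ne'⟩
  refine ⟨fun t => (γ t).1, fun t => (γ t).2.1, isGlobalGeneratingCurve_of_isCurveAt hl hm hH hγ,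
    by simp only [h0], by simp only [h0], ?_, ?_⟩
  · rw [(hγ s₀).deriv_x.deriv]; simp only [h0]
  · rw [(hγ s₀).deriv_y.deriv]; simp only [h0]
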